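/- Let $K$ transmitters (TXs) serve $K$ single-antenna receivers (RXs) jointly over the channel $\mathbf H=(H_{ik})\in\mathbb C^{K\times K}$, $H_{ik}=\mu^{|i-k|}G_{ik}$, where the $G_{ik}$ are i.i.d. $\mathcal{CN}(0,1)$ and $\mu=\mu(P)>0$ is a deterministic function of the power $P$ with $\mu\to 0$ as $P\to\infty$. Let $\bm h_i^{\mathrm H}$ be the $i$-th row of $\mathbf H$. TX $j$ has an estimate $\mathbf H^{(j)}$ of $\mathbf H$, computes the zero-forcing vectors $\bm t_i^{(j)}=\sqrt P\,(\mathbf H^{(j)})^{-1}\bm e_i/\|(\mathbf H^{(j)})^{-1}\bm e_i\|$ and uses only their $j$-th entries, so that the effective precoder is $\mathbf T=[\bm t_1,\dots,\bm t_K]$ with $T_{ji}=(\bm t_i^{(j)})_j$. With $$R_i=\mathrm E\Big[\log_2\Big(1+\frac{|\bm h_i^{\mathrm H}\bm t_i|^2}{1+\sum_{\ell\ne i}|\bm h_i^{\mathrm H}\bm t_\ell|^2}\Big)\Big]$$ (expectation over the fading and, if any, the random codebooks), the multiplexing gain (MG) of user $i$ is $\lim_{P\to\infty}R_i/\log_2P$.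 The maximal MG is said to be achieved if every user has MG $1$, where moreover $1$ is the greatest MG that user $i$ can obtain with any random precoder such that $\|\bm t_\ell\|^2=P$ for all $\ell$. A deterministic function $\gamma'=\gamma'(P)$, positive for large $P$, is called a decay rate of $\mathbf H^{-1}$ if, for almost every realization of $(G_{ik})$ and every $\theta\in(0,1)$, there is a constant $c$ such that $|(\mathbf H^{-1})_{ij}|\le c\,e^{-\theta\gamma'|i-j|}$ for all $i,j$ and all large $P$. Then $\mathbf H^{-1}$ has a decay rate $\gamma'$ with $e^{-\gamma'}\le\mu$ for all large $P$, and for every decay rate $\gamma'$ of $\mathbf H^{-1}$, with $\mu'=\exp(-\gamma')$, the following hold. 1. (Random vector quantization, RVQ.) Put $$B_i^{(j)}=(K-1)\max\Big(\log_2\Big(\frac P{\mu'^2}\,\frac{\mu'^{2|i-j|}}{\mu^{2|i-j|}}\Big),0\Big).$$ Suppose that the $i$-th row of $\mathbf H^{(j)}$ is the vector $\bm w$ that maximizes $|\bm w^{\mathrm H}\bm v_i|$, $\bm v_i$ being the $i$-th row of $\mathbf H$ written as a column, in a codebook of $2^{\lceil B_i^{(j)}\rceil}$ independent isotropic unit vectors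 of $\mathbb C^K$ that is independent of the fading, rotated by a phase so that its $i$-th entry is nonnegative (codebooks for different $(i,j)$ may be dependent). Then the maximal MG is achieved. 2. (Uniform scalar quantization.) Put $$B_{ik}^{(j)}=\max\Big(\log_2\Big(\frac P{\mu'^2}\,\frac{\mu'^{2|i-j|}}{\mu^{2|i-j|}}\,\mu^{2|k-j|}\Big),0\Big),\qquad n=\lceil B_{ik}^{(j)}\rceil .$$ Suppose that $H_{ik}^{(j)}=\mu^{|i-k|}\hat G_{ik}^{(j)}$. For $n\ge1$, the real and imaginary parts of $\hat G^{(j)}_{ik}$ are the outputs of uniform scalar quantizers with $b=\lceil n/2\rceil$ and $b=\lfloor n/2\rfloor$ bits applied to those of $G_{ik}$; a quantizer with $b$ bits divides $[-L_b,L_b]$ into $2^b$ cells of equal length and returns the midpoint of the cell of its input (of the nearest cell for an input outside $[-L_b,L_b]$). Here $L_b>0$ is any sequence with $L_b\to\infty$ and $\log(L_b)/b\to0$. For $n=0$, $\hat G^{(j)}_{ik}=a^{(j)}_{ik}$ is an arbitrary fixed number, subject only to $a^{(j)}_{ii}\neq0$. Then the maximal MG is achieved. -/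

import Mathlib

open MeasureTheory ProbabilityTheory Filter Topology

/-- The distance `|i - k|` between two indices. -/
def gap {K : ℕ} (i k : Fin K) : ℕ := ((i : ℤ) - (k : ℤ)).natAbs

/-- The exponentially decaying channel: the entrywise product of the fading matrix `G` and the
symmetric Toeplitz matrix generated by `(1, μ, …, μ^(K-1))`. Row `i` is the channel `hᵢᴴ` to
receiver `i`. -/
noncomputable def channel {K : ℕ} (μ : ℝ) (G : Matrix (Fin K) (Fin K) ℂ) :
    Matrix (Fin K) (Fin K) ℂ :=
  Matrix.of fun i k => (μ : ℂ) ^ gap i k * G i k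

/-- The circularly symmetric standard complex Gaussian law `CN(0,1)`. -/
noncomputable def stdComplexGaussian : Measure ℂ :=
  ((gaussianReal 0 (1 / 2)).prod (gaussianReal 0 (1 / 2))).map fun p => ⟨p.1, p.2⟩

/-- Standard Rayleigh fading: the entries of `G` are i.i.d. `CN(0,1)`. -/
def IsRayleigh {Ω : Type*} [MeasurableSpace Ω] (ν : Measure Ω) {K : ℕ}
    (G : Ω → Matrix (Fin K) (Fin K) ℂ) : Prop :=
  (∀ i k, Measurable fun ω => G ω i k) ∧
  iIndepFun (fun (p : Fin K × Fin K) ω => G ω p.1 p.2) ν ∧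
  ∀ i k, ν.map (fun ω => G ω i k) = stdComplexGaussian

/-- The Euclidean norm of a complex vector. -/
noncomputable def l2norm {K : ℕ} (v : Fin K → ℂ) : ℝ :=
  ‖(WithLp.toLp 2 v : EuclideanSpace ℂ (Fin K))‖

/-! ### Rates and multiplexing gain -/

/-- The rate (in bits) of user `i` for the channel `H` and the precoder `T`, whose `l`-th column is
the beamforming vector of stream `l`; the noise has unit variance. -/
noncomputable def instRate {K : ℕ} (H T : Matrix (Fin K) (Fin K) ℂ) (i : Fin K) : ℝ :=
  Real.logb 2 (1 + ‖(H * T) i i‖ ^ 2 / (1 + ∑ l ∈ Finset.univ.erase i, ‖(H * T) i l‖ ^ 2))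

/-- The average rate of user `i`. -/
noncomputable def avgRate {Ω : Type*} [MeasurableSpace Ω] (ν : Measure Ω) {K : ℕ}
    (H T : Ω → Matrix (Fin K) (Fin K) ℂ) (i : Fin K) : ℝ :=
  ∫ ω, instRate (H ω) (T ω) i ∂ν

/-- User `i` has multiplexing gain `m`, where `H P` and `T P` are the channel and the precoder
at power `P`. -/
def HasMG {Ω : Type*} [MeasurableSpace Ω] (ν : Measure Ω) {K : ℕ}
    (H T : ℝ → Ω → Matrix (Fin K) (Fin K) ℂ) (i : Fin K) (m : ℝ) : Prop :=
  Tendsto (fun P => avgRate ν (H P) (T P) i / Real.logb 2 P) atTop (𝓝 m)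

/-- The multiplexing gains of user `i` which are achievable with some precoder subject to the
per-stream power constraint `‖t_l‖² = P`, the precoder being allowed to depend in an arbitrary
measurable way on everything that is random. -/
def achievableMG {Ω : Type*} [MeasurableSpace Ω] (ν : Measure Ω) {K : ℕ}
    (H : ℝ → Ω → Matrix (Fin K) (Fin K) ℂ) (i : Fin K) : Set ℝ :=
  {m | ∃ T : ℝ → Ω → Matrix (Fin K) (Fin K) ℂ,
    (∀ P k l, Measurable fun ω => T P ω k l) ∧
    (∀ P, 0 < P → ∀ᵐ ω ∂ν, ∀ l, l2norm (fun k => T P ω k l) ^ 2 = P) ∧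
    HasMG ν H T i m}

/-- The precoder `T` achieves the maximal multiplexing gain: every user has multiplexing gain one,
and one is the greatest multiplexing gain achievable for that user. -/
def AchievesMaximalMG {Ω : Type*} [MeasurableSpace Ω] (ν : Measure Ω) {K : ℕ}
    (H T : ℝ → Ω → Matrix (Fin K) (Fin K) ℂ) : Prop :=
  ∀ i, HasMG ν H T i 1 ∧ IsGreatest (achievableMG ν H i) 1

/-! ### Distributed zero forcing -/

/-- The zero-forcing beamforming vector `√P A⁻¹ eᵢ / ‖A⁻¹ eᵢ‖` computed from the estimate `A`. -/
noncomputable def zfBeam {K : ℕ} (P : ℝ) (A : Matrix (Fin K) (Fin K) ℂ) (i : Fin K) : Fin K → ℂ :=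
  fun k => ((√P / l2norm (fun m => A⁻¹ m i) : ℝ) : ℂ) * A⁻¹ k i

/-- The effective precoder: its `j`-th row is computed at transmitter `j` from the estimate
`Hest j` available there. -/
noncomputable def effectivePrecoder {K : ℕ} (P : ℝ) (Hest : Fin K → Matrix (Fin K) (Fin K) ℂ) :
    Matrix (Fin K) (Fin K) ℂ :=
  Matrix.of fun j i => zfBeam P (Hest j) i j

/-! ### Exponential decay -/

/-- The matrices `A P` decay exponentially at the rate `γ P`: each smaller rate `θ γ P`, with
`0 < θ < 1`, gives an exponential bound with a constant that does not depend on `P`. -/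
def DecaysAtRate {K : ℕ} (A : ℝ → Matrix (Fin K) (Fin K) ℂ) (γ : ℝ → ℝ) : Prop :=
  ∀ θ : ℝ, 0 < θ → θ < 1 → ∃ c : ℝ, ∀ᶠ P in atTop, ∀ i j,
    ‖A P i j‖ ≤ c * Real.exp (-(θ * γ P) * gap i j)

/-- The inverse of the channel decays at the positive (deterministic) rate `γ'`, for almost every
realization of the fading. -/
def IsInverseDecayRate {Ω : Type*} [MeasurableSpace Ω] (ν : Measure Ω) {K : ℕ}
    (H : ℝ → Ω → Matrix (Fin K) (Fin K) ℂ) (γ' : ℝ → ℝ) : Prop :=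
  (∀ᶠ P in atTop, 0 < γ' P) ∧ ∀ᵐ ω ∂ν, DecaysAtRate (fun P => (H P ω)⁻¹) γ'

/-! ### Random vector quantization -/

/-- The isotropic law on the unit sphere of `ℂ^K`: the law of `g / ‖g‖` for a vector `g` with
i.i.d. `CN(0,1)` entries. -/
noncomputable def isotropicLaw (K : ℕ) : Measure (Fin K → ℂ) :=
  (Measure.pi fun _ : Fin K => stdComplexGaussian).map fun g k => g k / (l2norm g : ℂ)

/-- `W n`, `n = 0, 1, …`, are i.i.d. isotropic unit vectors which are independent of the fading.
A random codebook of size `N` consists of the first `N` of them. -/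
def IsRandomCodebook {Ω : Type*} [MeasurableSpace Ω] (ν : Measure Ω) {K : ℕ}
    (G : Ω → Matrix (Fin K) (Fin K) ℂ) (W : ℕ → Ω → Fin K → ℂ) : Prop :=
  (∀ n, Measurable (W n)) ∧
  iIndepFun W ν ∧
  (∀ n, ν.map (W n) = isotropicLaw K) ∧
  IndepFun (fun ω (p : Fin K × Fin K) => G ω p.1 p.2) (fun ω n => W n ω) ν

/-- The first of the codewords `w 0, …, w n` that maximizes `|⟨w, h⟩|`. -/
noncomputable def bestCodeword {K : ℕ} (w : ℕ → Fin K → ℂ) (h : Fin K → ℂ) : ℕ → Fin K → ℂ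
  | 0 => w 0
  | n + 1 =>
    if ‖star (bestCodeword w h n) ⬝ᵥ h‖ < ‖star (w (n + 1)) ⬝ᵥ h‖ then w (n + 1)
    else bestCodeword w h n

/-- The vector `v` rotated by a phase so that its `i`-th entry is real and nonnegative. -/
noncomputable def fixPhase {K : ℕ} (i : Fin K) (v : Fin K → ℂ) : Fin K → ℂ :=
  fun k => star (v i) / (‖v i‖ : ℂ) * v k

/-- The estimate of the channel matrix obtained by random vector quantization: row `i` of `H`
is quantized with `bits i` bits in the codebook of the first `2 ^ bits i` vectors of `w i`. A
codeword represents a direction, that is a vector up to a scalar; the common representative is the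
one whose direct entry (the `i`-th one for row `i`) is nonnegative. -/
noncomputable def rvqEstimate {K : ℕ} (bits : Fin K → ℕ) (w : Fin K → ℕ → Fin K → ℂ)
    (H : Matrix (Fin K) (Fin K) ℂ) : Matrix (Fin K) (Fin K) ℂ :=
  Matrix.of fun i => fixPhase i (bestCodeword (w i) (H i) (2 ^ bits i - 1))

/-- The number of bits for the channel vector of receiver `i` at transmitter `j`. -/
noncomputable def rvqBits (K : ℕ) (P μ μ' : ℝ) (i j : Fin K) : ℝ :=
  ((K : ℝ) - 1) *
    max (Real.logb 2 (P / μ' ^ 2 * (μ' ^ (2 * gap i j) / μ ^ (2 * gap i j)))) 0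

/-- The effective precoder under random vector quantization; `W i j` is the codebook used for the
channel of receiver `i` at transmitter `j`. -/
noncomputable def rvqPrecoder {Ω : Type*} {K : ℕ} (G : Ω → Matrix (Fin K) (Fin K) ℂ)
    (W : Fin K → Fin K → ℕ → Ω → Fin K → ℂ) (μ μ' : ℝ → ℝ) (P : ℝ) (ω : Ω) :
    Matrix (Fin K) (Fin K) ℂ :=
  effectivePrecoder P fun j =>
    rvqEstimate (fun i => ⌈rvqBits K P (μ P) (μ' P) i j⌉₊) (fun i n => W i j n ω)
      (channel (μ P) (G ω))

/-! ### Uniform scalar quantization -/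

/-- The uniform quantizer with `2 ^ b` cells of equal length on `[-L, L]`, which returns the
midpoint of the cell of `x`; values outside `[-L, L]` are assigned to the nearest cell. -/
noncomputable def uniformQuant (L : ℝ) (b : ℕ) (x : ℝ) : ℝ :=
  -L + (((max 0 (min ⌊(x + L) / (2 * L / 2 ^ b)⌋ (2 ^ b - 1)) : ℤ) : ℝ) + 1 / 2) * (2 * L / 2 ^ b)

/-- Quantization of a complex number of unit variance with `n` bits, of which `⌈n/2⌉` are used for
the real part and `⌊n/2⌋` for the imaginary part. The range `[-L b, L b]` depends on the number `b`
of bits used for the real number. With no bit at all, the nominal value `a` is used. -/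
noncomputable def scalarQuant (L : ℕ → ℝ) (a : ℂ) (n : ℕ) (g : ℂ) : ℂ :=
  if n = 0 then a
  else ⟨uniformQuant (L ((n + 1) / 2)) ((n + 1) / 2) g.re,
    uniformQuant (L (n / 2)) (n / 2) g.im⟩

/-- The ranges `[-L b, L b]` are admissible: they grow to the whole line, subexponentially in the
number `b` of bits. -/
def IsAdmissibleRange (L : ℕ → ℝ) : Prop :=
  (∀ b, 0 < L b) ∧ Tendsto L atTop atTop ∧
    Tendsto (fun b : ℕ => Real.log (L b) / b) atTop (𝓝 0)

/-- The number of bits for the channel coefficient `(i, k)` at transmitter `j`. -/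
noncomputable def scalarBits {K : ℕ} (P μ μ' : ℝ) (i k j : Fin K) : ℝ :=
  max (Real.logb 2
    (P / μ' ^ 2 * (μ' ^ (2 * gap i j) / μ ^ (2 * gap i j)) * μ ^ (2 * gap k j))) 0

/-- The effective precoder under uniform scalar quantization of each coefficient, where the
standard deviation `μ^|i-k|` of the coefficient `(i, k)` is known. -/
noncomputable def scalarPrecoder {Ω : Type*} {K : ℕ} (G : Ω → Matrix (Fin K) (Fin K) ℂ)
    (L : ℕ → ℝ) (a : Fin K → Matrix (Fin K) (Fin K) ℂ) (μ μ' : ℝ → ℝ) (P : ℝ) (ω : Ω) :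
    Matrix (Fin K) (Fin K) ℂ :=
  effectivePrecoder P fun j => channel (μ P) <| Matrix.of fun i k =>
    scalarQuant L (a j i k) ⌈scalarBits P (μ P) (μ' P) i k j⌉₊ (G ω i k)

/-! ### Index distances -/

/-! Two facts drive the proof: inverses of the matrices involved inherit the off-diagonal decay `μ ^
gap i j`, and TX `j` uses only the `j`-th entry of what it computes.

Let `U` be the channel with row `i` scaled by `D i`, let `A j` be the estimate at TX `j` up to
positive row scalings, which zero forcing does not see, and put `S j = (A j)⁻¹ * (A j - U)`. Then
`(A j)⁻¹ - U⁻¹ = -(S j * U⁻¹)`. The error of the `j`-th entry of a normalized column has two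
sources: the entry itself, controlled by row `j` of `S j`, and the norm of the column. The norm
involves all rows of `S j`, but it is multiplied by the `j`-th entry of the column of `U⁻¹`; by the
triangle inequality for indices, the decay turns this into a weight `μ ^ gap k j` on column `k` of
`S j`. So `norm_mul_effectivePrecoder_sub_le` needs only two bounds of the order `1 / √P` on `S j`.
A loss `P ^ ε` for every `ε` leaves the multiplexing gain unchanged (`eventually_le_instRate`).

The bit counts contain `μ'`, of which only the following matters: `μ' * (μ / μ') ^ d` stays bounded
for `d < K`. The entry of the inverse at two neighbouring indices is exactly of order `μ`, hence `μ`
is at most a constant times `μ' ^ θ` for each `θ < 1`, and `θ = 1 - 1 / K` suffices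
(`IsInverseDecayRate.eventually_le`).

For scalar quantization, `n` bits give an error of about `2 ^ (-n / 2)` for each fixed coefficient.
The prescribed number of bits, with the decay of the inverse of the estimate, yields both bounds on
`S j`, even with an extra factor `μ ^ gap r k`.

For random codebooks, a unit vector falls within distance `r` of a given line with probability at
least of order `r ^ (2 * (K - 1))`, so a codebook of `B` bits has a codeword at distance about `2 ^
(-B / (2 * (K - 1)))`. Borel–Cantelli makes this almost sure along a sequence of powers with `P ≥ 2
^ n`, at the price of a factor `n + 1`, which is only logarithmic in `P`. Here `D i = (G i i)⁻¹`,
since only directions are quantized.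

Since every sequence of powers has such a subsequence, and the rate is at most `log₂ P` plus an
integrable variable, dominated convergence transfers the almost sure bounds to the expectation
(`hasMG_one`). The same upper bound shows that no precoder exceeds gain one. -/

theorem gap_self {K : ℕ} (i : Fin K) : gap i i = 0 := by simp [gap]

theorem gap_comm {K : ℕ} (i k : Fin K) : gap i k = gap k i := by unfold gap; omega

theorem gap_triangle {K : ℕ} (i j k : Fin K) : gap i k ≤ gap i j + gap j k := by
  unfold gap; omega

theorem gap_lt {K : ℕ} (i k : Fin K) : gap i k < K := by unfold gap; omega

theorem gap_pos {K : ℕ} {i k : Fin K} (h : i ≠ k) : 0 < gap i k := by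
  have : (i : ℕ) ≠ k := fun e => h (Fin.ext e)
  unfold gap; omega

/-! ### Euclidean norm -/

theorem l2norm_nonneg {K : ℕ} (v : Fin K → ℂ) : 0 ≤ l2norm v := norm_nonneg _

theorem l2norm_sq {K : ℕ} (v : Fin K → ℂ) : l2norm v ^ 2 = ∑ k, ‖v k‖ ^ 2 := by
  simp [l2norm, EuclideanSpace.norm_sq_eq]

theorem norm_le_l2norm {K : ℕ} (v : Fin K → ℂ) (k : Fin K) : ‖v k‖ ≤ l2norm v := by
  simpa [l2norm] using PiLp.norm_apply_le (WithLp.toLp 2 v : EuclideanSpace ℂ (Fin K)) k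

theorem l2norm_le_sum {K : ℕ} (v : Fin K → ℂ) : l2norm v ≤ ∑ k, ‖v k‖ := by
  refine le_of_sq_le_sq ?_ (Finset.sum_nonneg fun _ _ => norm_nonneg _)
  rw [l2norm_sq]
  exact Finset.sum_sq_le_sq_sum_of_nonneg fun _ _ => norm_nonneg _

theorem abs_l2norm_sub_le {K : ℕ} (v w : Fin K → ℂ) :
    |l2norm v - l2norm w| ≤ l2norm (fun k => v k - w k) := by
  have := abs_norm_sub_norm_le (WithLp.toLp 2 v : EuclideanSpace ℂ (Fin K)) (WithLp.toLp 2 w)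
  simpa [l2norm, ← WithLp.toLp_sub, Pi.sub_def] using this

theorem l2norm_smul {K : ℕ} (c : ℂ) (v : Fin K → ℂ) :
    l2norm (fun k => c * v k) = ‖c‖ * l2norm v := by
  have := norm_smul c (WithLp.toLp 2 v : EuclideanSpace ℂ (Fin K))
  simpa [l2norm, ← WithLp.toLp_smul, Pi.smul_def] using this

theorem l2norm_eq_zero {K : ℕ} {v : Fin K → ℂ} : l2norm v = 0 ↔ ∀ k, v k = 0 := by
  simp [l2norm, funext_iff]

/-! ### Inverses of diagonally dominant matrices -/

theorem isUnit_det_of_dominant {K : ℕ} {A : Matrix (Fin K) (Fin K) ℂ} {c : ℝ} (hc : 0 < c)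
    (hd : ∀ i, c ≤ ‖A i i‖) (h : ∀ i k, k ≠ i → ‖A i k‖ ≤ c / (2 * K)) : IsUnit A.det := by
  rw [isUnit_iff_ne_zero]
  refine det_ne_zero_of_sum_row_lt_diag fun i => ?_
  have hK : (0 : ℝ) < K := by exact_mod_cast i.pos
  calc ∑ k ∈ Finset.univ.erase i, ‖A i k‖ ≤ ∑ k ∈ Finset.univ.erase i, c / (2 * K) :=
        Finset.sum_le_sum fun k hk => h i k (Finset.ne_of_mem_erase hk)
    _ ≤ ∑ k : Fin K, c / (2 * K) :=
        Finset.sum_le_sum_of_subset_of_nonneg (Finset.subset_univ _) fun _ _ _ => by positivity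
    _ = c / 2 := by simp; field_simp
    _ < ‖A i i‖ := by linarith [hd i]

/-- A maximum principle: choose the row `m` where `‖A⁻¹ m j‖ / w m` is largest and read off row `m`
of `A * A⁻¹ = 1`. The off-diagonal terms absorb at most half of the diagonal one. Weights that grow
away from the diagonal no faster than `A` decays turn this into decay of the inverse. -/
theorem norm_inv_le_of_weight {K : ℕ} {A : Matrix (Fin K) (Fin K) ℂ} (hdet : IsUnit A.det) {c : ℝ}
    (hc : 0 < c) (j : Fin K) {w : Fin K → ℝ} (hw : ∀ i, 0 < w i) (hwj : 1 ≤ w j)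
    (hd : ∀ i, c ≤ ‖A i i‖) (h : ∀ i k, k ≠ i → ‖A i k‖ * w k ≤ c / (2 * K) * w i) (i : Fin K) :
    ‖A⁻¹ i j‖ ≤ 2 / c * w i := by
  have hK : (0 : ℝ) < K := by exact_mod_cast i.pos
  have : Nonempty (Fin K) := ⟨i⟩
  obtain ⟨m, hm⟩ := Finite.exists_max fun r => ‖A⁻¹ r j‖ / w r
  set s := ‖A⁻¹ m j‖ / w m with hs
  have hs0 : 0 ≤ s := div_nonneg (norm_nonneg _) (hw m).le
  have hX : ∀ r, ‖A⁻¹ r j‖ ≤ s * w r := fun r => (div_le_iff₀ (hw r)).1 (hm r)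
  have hXm : ‖A⁻¹ m j‖ = s * w m := by rw [hs, div_mul_cancel₀ _ (hw m).ne']
  have hone : (A * A⁻¹) m j = (1 : Matrix (Fin K) (Fin K) ℂ) m j := by
    rw [Matrix.mul_nonsing_inv _ hdet]
  rw [Matrix.mul_apply, ← Finset.add_sum_erase _ _ (Finset.mem_univ m)] at hone
  have hsum : ‖∑ k ∈ Finset.univ.erase m, A m k * A⁻¹ k j‖ ≤ c / 2 * s * w m := by
    calc _ ≤ ∑ k ∈ Finset.univ.erase m, ‖A m k * A⁻¹ k j‖ := norm_sum_le _ _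
      _ ≤ ∑ k ∈ Finset.univ.erase m, c / (2 * K) * w m * s := by
          refine Finset.sum_le_sum fun k hk => ?_
          rw [norm_mul]
          calc ‖A m k‖ * ‖A⁻¹ k j‖ ≤ ‖A m k‖ * (s * w k) := by gcongr; exact hX k
            _ = (‖A m k‖ * w k) * s := by ring
            _ ≤ _ := mul_le_mul_of_nonneg_right (h m k (Finset.ne_of_mem_erase hk)) hs0
      _ ≤ ∑ k : Fin K, c / (2 * K) * w m * s :=
          Finset.sum_le_sum_of_subset_of_nonneg (Finset.subset_univ _) fun _ _ _ => by
            have := (hw m).le; positivity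
      _ = c / 2 * s * w m := by simp; field_simp
  have hdelta : ‖(1 : Matrix (Fin K) (Fin K) ℂ) m j‖ ≤ w m := by
    by_cases hmj : m = j
    · subst hmj; simpa using hwj
    · simpa [Matrix.one_apply_ne hmj] using (hw m).le
  have hmain : c * (s * w m) ≤ w m + c / 2 * s * w m := by
    calc c * (s * w m) ≤ ‖A m m‖ * ‖A⁻¹ m j‖ := by rw [hXm]; have := (hw m).le; gcongr; exact hd m
      _ = ‖(1 : Matrix (Fin K) (Fin K) ℂ) m j -
            ∑ k ∈ Finset.univ.erase m, A m k * A⁻¹ k j‖ := by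
          rw [← hone, add_sub_cancel_right, norm_mul]
      _ ≤ _ := (norm_sub_le _ _).trans (add_le_add hdelta hsum)
  have hs2 : s ≤ 2 / c := by
    rw [le_div_iff₀ hc]
    have := hw m
    nlinarith [mul_pos this hc]
  exact (hX i).trans (mul_le_mul_of_nonneg_right hs2 (hw i).le)

theorem norm_channel {K : ℕ} {μ : ℝ} (hμ : 0 ≤ μ) (G : Matrix (Fin K) (Fin K) ℂ) (i k : Fin K) :
    ‖channel μ G i k‖ = μ ^ gap i k * ‖G i k‖ := by
  simp [channel, abs_of_nonneg hμ]

/-- The inverse of the channel matrix has the same exponential decay as the channel matrix. -/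
theorem channel_inv_decay (K : ℕ) {M c : ℝ} (hM : 0 < M) (hc : 0 < c) :
    ∃ C > 0, ∃ δ > 0, δ ≤ 1 ∧ ∀ μ : ℝ, 0 < μ → μ ≤ δ → ∀ G : Matrix (Fin K) (Fin K) ℂ,
      (∀ i k, ‖G i k‖ ≤ M) → (∀ i, c ≤ ‖G i i‖) →
      IsUnit (channel μ G).det ∧ ∀ i j, ‖(channel μ G)⁻¹ i j‖ ≤ C * μ ^ gap i j := by
  rcases Nat.eq_zero_or_pos K with rfl | hKpos
  · exact ⟨1, one_pos, 1, one_pos, le_rfl, fun μ _ _ G _ _ => ⟨by simp, fun i => i.elim0⟩⟩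
  have hK : (0 : ℝ) < K := by exact_mod_cast hKpos
  -- The weight will be `(t * μ) ^ gap i j` rather than `μ ^ gap i j`. Each off-diagonal entry then
  -- gains a factor `1 / t`, and `M / t ≤ c / (2 * K)` is the required dominance. The price is the
  -- factor `t ^ K` in the final constant.
  set t : ℝ := 2 * K * M / c + 1 with ht
  have ht1 : 1 ≤ t := by rw [ht]; have : 0 ≤ 2 * K * M / c := by positivity
                         linarith
  have ht0 : 0 < t := by linarith
  have htM : M / t ≤ c / (2 * K) := by
    rw [div_le_div_iff₀ ht0 (by positivity), ht]
    field_simp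
    nlinarith
  refine ⟨2 / c * t ^ K, by positivity, 1 / t, by positivity, by rw [div_le_one ht0]; exact ht1,
    fun μ hμ hμt G hGM hGc => ?_⟩
  have htμ : t * μ ≤ 1 := by rwa [le_div_iff₀ ht0, mul_comm] at hμt
  have hμ1 : μ ≤ 1 := by nlinarith
  have htμ0 : 0 < t * μ := by positivity
  have hdiag : ∀ i, c ≤ ‖channel μ G i i‖ := fun i => by
    rw [norm_channel hμ.le, gap_self, pow_zero, one_mul]; exact hGc i
  have hoff : ∀ i k : Fin K, k ≠ i → μ ^ gap i k ≤ (t * μ) ^ gap i k / t := fun i k hki => by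
    have h1 := gap_pos hki.symm
    rw [le_div_iff₀ ht0, mul_pow, mul_comm]
    gcongr
    calc t = t ^ 1 := (pow_one t).symm
      _ ≤ t ^ gap i k := pow_le_pow_right₀ ht1 h1
  have hunit : IsUnit (channel μ G).det := by
    refine isUnit_det_of_dominant hc hdiag fun i k hki => ?_
    rw [norm_channel hμ.le]
    calc μ ^ gap i k * ‖G i k‖ ≤ ((t * μ) ^ gap i k / t) * M := by
          gcongr
          · exact hoff i k hki
          · exact hGM i k
      _ ≤ (1 / t) * M := by gcongr; exact pow_le_one₀ htμ0.le htμ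
      _ = M / t := by ring
      _ ≤ _ := htM
  refine ⟨hunit, fun i j => ?_⟩
  have := norm_inv_le_of_weight hunit hc j (w := fun i => (t * μ) ^ gap i j)
    (fun _ => by positivity) (by simp [gap_self]) hdiag (fun i k hki => ?_) i
  · calc _ ≤ 2 / c * (t * μ) ^ gap i j := this
      _ = 2 / c * t ^ gap i j * μ ^ gap i j := by rw [mul_pow]; ring
      _ ≤ _ := by gcongr; exact (gap_lt i j).le
  · rw [norm_channel hμ.le]
    calc μ ^ gap i k * ‖G i k‖ * (t * μ) ^ gap k j
        ≤ ((t * μ) ^ gap i k / t) * M * (t * μ) ^ gap k j := by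
          gcongr
          · exact hoff i k hki
          · exact hGM i k
      _ = M / t * (t * μ) ^ (gap i k + gap k j) := by rw [pow_add]; ring
      _ ≤ c / (2 * K) * (t * μ) ^ gap i j := by
          gcongr ?_ * ?_
          exact pow_le_pow_of_le_one htμ0.le htμ (gap_triangle i k j)

/-! ### Zero forcing with perturbed channel matrices -/

/-- Row `l` of `A` times column `l` of `A⁻¹` is one, so this column cannot be short. This keeps the
normalization in zero forcing stable. -/
theorem one_le_mul_l2norm_inv {K : ℕ} {A : Matrix (Fin K) (Fin K) ℂ} (hA : IsUnit A.det) {M : ℝ}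
    (hM : ∀ i k, ‖A i k‖ ≤ M) (l : Fin K) : 1 ≤ K * M * l2norm (fun m => A⁻¹ m l) := by
  have hone : (A * A⁻¹) l l = 1 := by rw [Matrix.mul_nonsing_inv _ hA]; simp
  have hM0 : 0 ≤ M := (norm_nonneg _).trans (hM l l)
  calc (1 : ℝ) = ‖(A * A⁻¹) l l‖ := by rw [hone]; simp
    _ ≤ ∑ k, ‖A l k * A⁻¹ k l‖ := by rw [Matrix.mul_apply]; exact norm_sum_le _ _
    _ ≤ ∑ _k : Fin K, M * l2norm (fun m => A⁻¹ m l) := by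
        refine Finset.sum_le_sum fun k _ => ?_
        rw [norm_mul]
        gcongr
        · exact hM l k
        · exact norm_le_l2norm (fun m => A⁻¹ m l) k
    _ = _ := by simp; ring

/-- The zero-forcing vectors do not depend on positive scalings of the rows. -/
theorem zfBeam_diagonal_mul {K : ℕ} (P : ℝ) (A : Matrix (Fin K) (Fin K) ℂ) {ρ : Fin K → ℝ}
    (hρ : ∀ i, 0 < ρ i) (i : Fin K) :
    zfBeam P (Matrix.diagonal (fun i => (ρ i : ℂ)) * A) i = zfBeam P A i := by
  have hinv : ∀ m, (Matrix.diagonal (fun i => (ρ i : ℂ)) * A)⁻¹ m i = ((ρ i)⁻¹ : ℂ) * A⁻¹ m i := by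
    intro m
    have hd : (Matrix.diagonal (fun i => (ρ i : ℂ)))⁻¹ = Matrix.diagonal (fun i => ((ρ i)⁻¹ : ℂ)) := by
      refine Matrix.inv_eq_left_inv ?_
      rw [Matrix.diagonal_mul_diagonal, ← Matrix.diagonal_one]
      congr 1
      funext r
      exact inv_mul_cancel₀ (by exact_mod_cast (hρ r).ne')
    rw [Matrix.mul_inv_rev, hd, Matrix.mul_diagonal, mul_comm]
  have hn : ‖((ρ i)⁻¹ : ℂ)‖ = (ρ i)⁻¹ := by simp [abs_of_pos (hρ i)]
  have hne : (ρ i : ℂ) ≠ 0 := by exact_mod_cast (hρ i).ne'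
  funext k
  simp only [zfBeam, hinv, l2norm_smul, hn]
  push_cast
  by_cases h0 : (l2norm (fun m => A⁻¹ m i) : ℂ) = 0
  · simp [h0]
  · field_simp

theorem norm_zfBeam_le {K : ℕ} (P : ℝ) (A : Matrix (Fin K) (Fin K) ℂ) (i k : Fin K) :
    ‖zfBeam P A i k‖ ≤ √P := by
  rw [zfBeam, norm_mul, Complex.norm_real, Real.norm_eq_abs,
    abs_of_nonneg (div_nonneg (Real.sqrt_nonneg _) (l2norm_nonneg _)), div_mul_eq_mul_div]
  exact div_le_of_le_mul₀ (l2norm_nonneg _) (Real.sqrt_nonneg _)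
    (mul_le_mul_of_nonneg_left (norm_le_l2norm (fun m => A⁻¹ m i) k) (Real.sqrt_nonneg _))

/-- The error of the norm enters only multiplied by `‖b j‖`. Keeping this factor is essential: for
entries far from the diagonal it is small and compensates for coarse estimates elsewhere. -/
theorem norm_div_l2norm_sub_le {K : ℕ} (a b : Fin K → ℂ) {B : ℝ} (hB : 0 ≤ B)
    (ha : 1 ≤ B * l2norm a) (hb : 1 ≤ B * l2norm b) (j : Fin K) :
    ‖a j / (l2norm a : ℂ) - b j / (l2norm b : ℂ)‖ ≤
      B * ‖a j - b j‖ + B ^ 2 * (‖b j‖ * ∑ r, ‖a r - b r‖) := by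
  have ha0 : 0 < l2norm a := by
    by_contra h
    nlinarith [l2norm_nonneg a]
  have hb0 : 0 < l2norm b := by
    by_contra h
    nlinarith [l2norm_nonneg b]
  have hac : (l2norm a : ℂ) ≠ 0 := by exact_mod_cast ha0.ne'
  have hbc : (l2norm b : ℂ) ≠ 0 := by exact_mod_cast hb0.ne'
  have hai : (l2norm a)⁻¹ ≤ B := by rwa [inv_le_iff_one_le_mul₀ ha0]
  have hbi : (l2norm b)⁻¹ ≤ B := by rwa [inv_le_iff_one_le_mul₀ hb0]
  have hsplit : a j / (l2norm a : ℂ) - b j / (l2norm b : ℂ) =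
      (l2norm a : ℂ)⁻¹ * (a j - b j) +
        (l2norm a : ℂ)⁻¹ * (l2norm b : ℂ)⁻¹ * (b j * ((l2norm b - l2norm a : ℝ) : ℂ)) := by
    push_cast; field_simp; ring
  have hdiff : |l2norm b - l2norm a| ≤ ∑ r, ‖a r - b r‖ := by
    rw [abs_sub_comm]
    exact (abs_l2norm_sub_le a b).trans (l2norm_le_sum _)
  rw [hsplit]
  refine (norm_add_le _ _).trans (add_le_add ?_ ?_)
  · rw [norm_mul, norm_inv, Complex.norm_real, Real.norm_eq_abs, abs_of_pos ha0]
    gcongr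
  · rw [norm_mul, norm_mul, norm_mul, norm_inv, norm_inv, Complex.norm_real, Complex.norm_real,
      Complex.norm_real, Real.norm_eq_abs, Real.norm_eq_abs, Real.norm_eq_abs, abs_of_pos ha0,
      abs_of_pos hb0, sq]
    have : 0 ≤ (l2norm b)⁻¹ := inv_nonneg.2 hb0.le
    gcongr

/-- If the relative errors `A j⁻¹ (A j - U)` of the estimates are small, where `U` is obtained from
the channel `H` by scaling its rows, then the effective precoder nearly is the zero-forcing
precoder of `H`. -/
theorem norm_mul_effectivePrecoder_sub_le {K : ℕ} {H U : Matrix (Fin K) (Fin K) ℂ}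
    {D : Fin K → ℂ} (hUH : ∀ i k, U i k = D i * H i k)
    {A : Fin K → Matrix (Fin K) (Fin K) ℂ} {μ P M C Q : ℝ} (hμ : 0 < μ) (hμ1 : μ ≤ 1)
    (hC : 0 ≤ C) (hUdet : IsUnit U.det) (hUinv : ∀ i j, ‖U⁻¹ i j‖ ≤ C * μ ^ gap i j)
    (hHM : ∀ i k, ‖H i k‖ ≤ M) (hUM : ∀ i k, ‖U i k‖ ≤ M) (hAdet : ∀ j, IsUnit (A j).det)
    (hAM : ∀ j i k, ‖A j i k‖ ≤ M)
    (hS : ∀ j k, √P * ‖((A j)⁻¹ * (A j - U)) j k‖ ≤ Q)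
    (hS' : ∀ j r k, √P * ‖((A j)⁻¹ * (A j - U)) r k‖ * μ ^ gap k j ≤ Q) (i l : Fin K) :
    ‖D i * (H * effectivePrecoder P A) i l -
        if i = l then ((√P / l2norm (fun m => U⁻¹ m l) : ℝ) : ℂ) else 0‖ ≤
      ‖D i‖ * (K * M * (K * M * (K * C) + (K * M) ^ 2 * (K ^ 2 * C ^ 2)) * Q) := by
  have hM : 0 ≤ M := (norm_nonneg _).trans (hHM i i)
  set b : Fin K → ℂ := fun m => U⁻¹ m l with hb
  set a : Fin K → Fin K → ℂ := fun j m => (A j)⁻¹ m l with ha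
  set S : Fin K → Matrix (Fin K) (Fin K) ℂ := fun j => (A j)⁻¹ * (A j - U) with hSdef
  have hQ : 0 ≤ Q := (mul_nonneg (Real.sqrt_nonneg _) (norm_nonneg _)).trans (hS i i)
  have hab : ∀ j r, ‖a j r - b r‖ ≤ ∑ k, ‖S j r k‖ * ‖b k‖ := by
    intro j r
    -- The first-order factor `S j` is exact here: no Neumann series or smallness is needed.
    have hmat : (A j)⁻¹ - U⁻¹ = -(S j * U⁻¹) := by
      rw [hSdef]
      simp only
      rw [mul_sub, Matrix.nonsing_inv_mul _ (hAdet j), sub_mul, one_mul, Matrix.mul_assoc,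
        Matrix.mul_nonsing_inv _ hUdet, mul_one, neg_sub]
    have h1 : a j r - b r = -∑ k, S j r k * b k := by
      have := congrFun (congrFun hmat r) l
      rwa [Matrix.sub_apply, Matrix.neg_apply, Matrix.mul_apply] at this
    rw [h1, norm_neg]
    exact (norm_sum_le _ _).trans (Finset.sum_le_sum fun k _ => (norm_mul _ _).le)
  have hbC : ∀ k, ‖b k‖ ≤ C := fun k =>
    (hUinv k l).trans (mul_le_of_le_one_right hC (pow_le_one₀ hμ.le hμ1))
  have hab1 : ∀ j, √P * ‖a j j - b j‖ ≤ K * C * Q := by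
    intro j
    calc √P * ‖a j j - b j‖ ≤ √P * ∑ k, ‖S j j k‖ * ‖b k‖ := by gcongr; exact hab j j
      _ = ∑ k, (√P * ‖S j j k‖) * ‖b k‖ := by rw [Finset.mul_sum]; simp only [mul_assoc]
      _ ≤ ∑ _k : Fin K, Q * C := by
          refine Finset.sum_le_sum fun k _ => ?_
          gcongr
          · exact hS j k
          · exact hbC k
      _ = _ := by simp; ring
  have hab2 : ∀ j, √P * (‖b j‖ * ∑ r, ‖a j r - b r‖) ≤ K ^ 2 * C ^ 2 * Q := by
    intro j
    calc √P * (‖b j‖ * ∑ r, ‖a j r - b r‖)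
        ≤ √P * (‖b j‖ * ∑ r, ∑ k, ‖S j r k‖ * ‖b k‖) := by
          gcongr with r _
          exact hab j r
      _ = ∑ r, ∑ k, √P * ‖S j r k‖ * (‖b j‖ * ‖b k‖) := by
          simp only [Finset.mul_sum]
          refine Finset.sum_congr rfl fun r _ => Finset.sum_congr rfl fun k _ => by ring
      _ ≤ ∑ _r : Fin K, ∑ _k : Fin K, Q * C ^ 2 := by
          refine Finset.sum_le_sum fun r _ => Finset.sum_le_sum fun k _ => ?_
          -- Going from `k` to `j` through `l` costs at least `gap k j`; this produces the weight in
          -- `hS'`.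
          have h1 : ‖b j‖ * ‖b k‖ ≤ C ^ 2 * μ ^ gap k j := by
            calc ‖b j‖ * ‖b k‖ ≤ (C * μ ^ gap j l) * (C * μ ^ gap k l) := by
                  gcongr
                  · exact hUinv j l
                  · exact hUinv k l
              _ = C ^ 2 * μ ^ (gap k l + gap l j) := by rw [pow_add, gap_comm l j]; ring
              _ ≤ _ := by
                  gcongr ?_ * ?_
                  exact pow_le_pow_of_le_one hμ.le hμ1 (gap_triangle k l j)
          calc √P * ‖S j r k‖ * (‖b j‖ * ‖b k‖) ≤ √P * ‖S j r k‖ * (C ^ 2 * μ ^ gap k j) := by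
                gcongr
            _ = (√P * ‖S j r k‖ * μ ^ gap k j) * C ^ 2 := by ring
            _ ≤ Q * C ^ 2 := by gcongr; exact hS' j r k
      _ = _ := by simp; ring
  have hB : 0 ≤ K * M := by positivity
  have hdiff : ∀ j, ‖effectivePrecoder P A j l - (√P : ℂ) * (b j / (l2norm b : ℂ))‖ ≤
      (K * M * (K * C) + (K * M) ^ 2 * (K ^ 2 * C ^ 2)) * Q := by
    intro j
    have hT : effectivePrecoder P A j l = (√P : ℂ) * (a j j / (l2norm (a j) : ℂ)) := by
      simp only [effectivePrecoder, zfBeam, Matrix.of_apply, ha]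
      push_cast
      ring
    rw [hT, ← mul_sub, norm_mul, Complex.norm_real, Real.norm_eq_abs,
      abs_of_nonneg (Real.sqrt_nonneg _)]
    calc _ ≤ √P * (K * M * ‖a j j - b j‖ + (K * M) ^ 2 * (‖b j‖ * ∑ r, ‖a j r - b r‖)) := by
          gcongr
          exact norm_div_l2norm_sub_le (a j) b hB (one_le_mul_l2norm_inv (hAdet j) (hAM j) l)
            (one_le_mul_l2norm_inv hUdet hUM l) j
      _ = K * M * (√P * ‖a j j - b j‖) +
            (K * M) ^ 2 * (√P * (‖b j‖ * ∑ r, ‖a j r - b r‖)) := by ring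
      _ ≤ K * M * (K * C * Q) + (K * M) ^ 2 * (K ^ 2 * C ^ 2 * Q) :=
          add_le_add (mul_le_mul_of_nonneg_left (hab1 j) hB)
            (mul_le_mul_of_nonneg_left (hab2 j) (sq_nonneg _))
      _ = _ := by ring
  -- The ideal zero-forcing vector is orthogonal to all rows but row `l`, so the received signal
  -- differs from the ideal one by the precoder error alone.
  have hid : (if i = l then ((√P / l2norm b : ℝ) : ℂ) else 0) =
      D i * ∑ j, H i j * ((√P : ℂ) * (b j / (l2norm b : ℂ))) := by
    have hone : ∑ j, U i j * b j = (1 : Matrix (Fin K) (Fin K) ℂ) i l := by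
      rw [← Matrix.mul_nonsing_inv _ hUdet, Matrix.mul_apply]
    rw [Finset.mul_sum]
    calc _ = (√P : ℂ) / (l2norm b : ℂ) * ∑ j, U i j * b j := by
          rw [hone, Matrix.one_apply]
          split_ifs <;> simp
      _ = _ := by
          rw [Finset.mul_sum]
          refine Finset.sum_congr rfl fun j _ => ?_
          rw [hUH]; ring
  rw [hid, Matrix.mul_apply, ← mul_sub, ← Finset.sum_sub_distrib, norm_mul]
  gcongr
  calc _ ≤ ∑ j, ‖H i j‖ * ‖effectivePrecoder P A j l - (√P : ℂ) * (b j / (l2norm b : ℂ))‖ := by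
        refine (norm_sum_le _ _).trans (Finset.sum_le_sum fun j _ => ?_)
        rw [← mul_sub, norm_mul]
    _ ≤ ∑ _j : Fin K, M * ((K * M * (K * C) + (K * M) ^ 2 * (K ^ 2 * C ^ 2)) * Q) := by
        refine Finset.sum_le_sum fun j _ => ?_
        gcongr
        · exact hHM i j
        · exact hdiff j
    _ = _ := by simp; ring

/-! ### Asymptotic bounds for the rates -/

theorem instRate_nonneg {K : ℕ} (H T : Matrix (Fin K) (Fin K) ℂ) (i : Fin K) :
    0 ≤ instRate H T i := by
  refine Real.logb_nonneg one_lt_two (le_add_of_nonneg_right ?_)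
  positivity

/-- If the interference grows more slowly than each power of `p` and the signal is at least of the
order of `√p`, then the rate is asymptotically at least `log₂ p`. -/
theorem eventually_le_instRate {ι : Type*} {l : Filter ι} {p : ι → ℝ} (hp : Tendsto p l atTop)
    {K : ℕ} {H T : ι → Matrix (Fin K) (Fin K) ℂ} {i : Fin K} {c : ℝ} (hc : 0 < c)
    (h : ∀ ε : ℝ, 0 < ε → ∃ C : ℝ, ∀ᶠ n in l, (∀ k, k ≠ i → ‖(H n * T n) i k‖ ≤ C * p n ^ ε) ∧
      c * √(p n) - C * p n ^ ε ≤ ‖(H n * T n) i i‖) {ε : ℝ} (hε : 0 < ε) :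
    ∀ᶠ n in l, (1 - ε) * Real.logb 2 (p n) ≤ instRate (H n) (T n) i := by
  -- Interference power is of order `p ^ (2 * δ)`, and `p ^ (1 - 4 * δ) * p ^ (2 * δ)` is still
  -- negligible against the signal power of order `p`. The bound by `1` keeps `δ < 1 / 2`, so that
  -- the error is negligible against `√p`.
  set δ := min ε 1 / 4 with hδ
  have hδ0 : 0 < δ := by positivity
  have hδε : 4 * δ ≤ ε := by rw [hδ]; linarith [min_le_left ε 1]
  have hδ1 : 4 * δ ≤ 1 := by rw [hδ]; linarith [min_le_right ε 1]
  obtain ⟨C, hC⟩ := h δ hδ0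
  have hlim : ∀ a : ℝ, 0 < a → Tendsto (fun n => p n ^ (-a)) l (𝓝 0) := fun a ha =>
    (tendsto_rpow_neg_atTop ha).comp hp
  have h1 : ∀ᶠ n in l, C * p n ^ (-(1 / 2 - δ)) < c / 2 := by
    have := (hlim (1 / 2 - δ) (by linarith)).const_mul C
    rw [mul_zero] at this
    exact this.eventually (gt_mem_nhds (by positivity))
  have h2 : ∀ᶠ n in l, p n ^ (-(4 * δ)) + K * C ^ 2 * p n ^ (-(2 * δ)) < c ^ 2 / 4 := by
    have := (hlim (4 * δ) (by linarith)).add ((hlim (2 * δ) (by linarith)).const_mul (K * C ^ 2))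
    rw [mul_zero, add_zero] at this
    exact this.eventually (gt_mem_nhds (by positivity))
  filter_upwards [hC, h1, h2, hp.eventually_ge_atTop 1] with n hn hn1 hn2 hp1
  have hp0 : 0 < p n := by linarith
  obtain ⟨hoff, hdiag⟩ := hn
  have hsig : c / 2 * √(p n) ≤ ‖(H n * T n) i i‖ := by
    have : C * p n ^ δ ≤ c / 2 * √(p n) := by
      have e : p n ^ δ = p n ^ (-(1 / 2 - δ)) * √(p n) := by
        rw [Real.sqrt_eq_rpow, ← Real.rpow_add hp0]; congr 1; ring
      rw [e, ← mul_assoc]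
      exact mul_le_mul_of_nonneg_right hn1.le (Real.sqrt_nonneg _)
    linarith
  have hsig2 : c ^ 2 / 4 * p n ≤ ‖(H n * T n) i i‖ ^ 2 := by
    calc c ^ 2 / 4 * p n = (c / 2 * √(p n)) ^ 2 := by rw [mul_pow, Real.sq_sqrt hp0.le]; ring
      _ ≤ _ := by gcongr
  have hint : ∑ k ∈ Finset.univ.erase i, ‖(H n * T n) i k‖ ^ 2 ≤ K * C ^ 2 * p n ^ (2 * δ) := by
    calc _ ≤ ∑ k ∈ Finset.univ.erase i, C ^ 2 * p n ^ (2 * δ) := by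
          refine Finset.sum_le_sum fun k hk => ?_
          calc ‖(H n * T n) i k‖ ^ 2 ≤ (C * p n ^ δ) ^ 2 := by
                gcongr; exact hoff k (Finset.ne_of_mem_erase hk)
            _ = _ := by rw [mul_pow, ← Real.rpow_natCast (p n ^ δ), ← Real.rpow_mul hp0.le]
                        congr 2; push_cast; ring
      _ ≤ ∑ _k : Fin K, C ^ 2 * p n ^ (2 * δ) :=
          Finset.sum_le_sum_of_subset_of_nonneg (Finset.subset_univ _) fun _ _ _ => by positivity
      _ = _ := by simp; ring
  have hI : 0 ≤ ∑ k ∈ Finset.univ.erase i, ‖(H n * T n) i k‖ ^ 2 :=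
    Finset.sum_nonneg fun _ _ => sq_nonneg _
  rw [instRate]
  generalize ∑ k ∈ Finset.univ.erase i, ‖(H n * T n) i k‖ ^ 2 = I at hI hint ⊢
  have hkey : p n ^ (1 - ε) ≤ ‖(H n * T n) i i‖ ^ 2 / (1 + I) := by
    rw [le_div_iff₀ (by linarith)]
    calc p n ^ (1 - ε) * (1 + I)
        ≤ p n ^ (1 - 4 * δ) * (1 + K * C ^ 2 * p n ^ (2 * δ)) := by
          refine mul_le_mul (Real.rpow_le_rpow_of_exponent_le hp1 (by linarith)) (by linarith)
            (by linarith) (Real.rpow_nonneg hp0.le _)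
      _ = (p n ^ (-(4 * δ)) + K * C ^ 2 * p n ^ (-(2 * δ))) * p n := by
          have e1 : p n ^ (1 - 4 * δ) = p n ^ (-(4 * δ)) * p n := by
            rw [← Real.rpow_add_one hp0.ne']; congr 1; ring
          have e2 : p n ^ (-(4 * δ)) * p n ^ (2 * δ) = p n ^ (-(2 * δ)) := by
            rw [← Real.rpow_add hp0]; congr 1; ring
          rw [e1, ← e2]; ring
      _ ≤ c ^ 2 / 4 * p n := by gcongr
      _ ≤ _ := hsig2
  calc (1 - ε) * Real.logb 2 (p n) = Real.logb 2 (p n ^ (1 - ε)) :=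
        (Real.logb_rpow_eq_mul_logb_of_pos hp0).symm
    _ ≤ _ := by
        refine Real.logb_le_logb_of_le one_lt_two (Real.rpow_pos_of_pos hp0 _) ?_
        linarith

theorem exists_bounds_of_diag_ne_zero {K : ℕ} (G : Matrix (Fin K) (Fin K) ℂ)
    (hG : ∀ i, G i i ≠ 0) :
    ∃ M > 0, ∃ c > 0, (∀ i k, ‖G i k‖ ≤ M) ∧ ∀ i, c ≤ ‖G i i‖ := by
  obtain ⟨M, hM⟩ := (Set.finite_range fun q : Fin K × Fin K => ‖G q.1 q.2‖).bddAbove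
  have hc : ∃ c > 0, ∀ i, c ≤ ‖G i i‖ := by
    rcases isEmpty_or_nonempty (Fin K) with h | h
    · exact ⟨1, one_pos, fun i => h.elim i⟩
    · obtain ⟨m, hm⟩ := Finite.exists_min fun i => ‖G i i‖
      exact ⟨‖G m m‖, norm_pos_iff.2 (hG m), hm⟩
  obtain ⟨c, hc0, hc⟩ := hc
  exact ⟨max M 1, by positivity, c, hc0,
    fun i k => le_max_of_le_left (hM ⟨(i, k), rfl⟩), hc⟩

/-- Zero forcing with estimates whose relative errors are of the order `p ^ (-1/2 + ε)` for every
`ε` is asymptotically as good as interference-free transmission. -/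
theorem eventually_le_instRate_effectivePrecoder {ι : Type*} {l : Filter ι} {p m : ι → ℝ}
    (hp : Tendsto p l atTop) (hm0 : ∀ᶠ n in l, 0 < m n) (hm : Tendsto m l (𝓝 0)) {K : ℕ}
    {G : Matrix (Fin K) (Fin K) ℂ} (hG : ∀ i, G i i ≠ 0) {D : Fin K → ℂ} (hD : ∀ i, D i ≠ 0)
    {A : ι → Fin K → Matrix (Fin K) (Fin K) ℂ} {M : ℝ}
    (hA : ∀ᶠ n in l, ∀ j, IsUnit (A n j).det ∧ ∀ i k, ‖A n j i k‖ ≤ M)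
    (hS : ∀ ε : ℝ, 0 < ε → ∃ C : ℝ, ∀ᶠ n in l, ∀ j,
      (∀ k, √(p n) * ‖((A n j)⁻¹ *
        (A n j - channel (m n) (Matrix.of fun i k => D i * G i k))) j k‖ ≤ C * p n ^ ε) ∧
      ∀ r k, √(p n) * ‖((A n j)⁻¹ *
        (A n j - channel (m n) (Matrix.of fun i k => D i * G i k))) r k‖ * m n ^ gap k j ≤
          C * p n ^ ε) (i : Fin K) {ε : ℝ} (hε : 0 < ε) :
    ∀ᶠ n in l, (1 - ε) * Real.logb 2 (p n) ≤
      instRate (channel (m n) G) (effectivePrecoder (p n) (A n)) i := by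
  have hK : (0 : ℝ) < K := by exact_mod_cast i.pos
  set G' : Matrix (Fin K) (Fin K) ℂ := Matrix.of fun i k => D i * G i k with hG'
  obtain ⟨M₁, hM₁, c₁, hc₁, hGM, -⟩ := exists_bounds_of_diag_ne_zero G hG
  obtain ⟨M₂, hM₂, c₂, hc₂, hGM', hGc'⟩ := exists_bounds_of_diag_ne_zero G' fun i => by
    simpa [hG'] using ⟨hD i, hG i⟩
  obtain ⟨C₀, hC₀, δ, hδ, hδ1, hdecay⟩ := channel_inv_decay K hM₂ hc₂
  set M' := max M (max M₁ M₂) with hM'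
  have hM'0 : 0 < M' := by rw [hM']; positivity
  set F := K * M' * (K * M' * (K * C₀) + (K * M') ^ 2 * (K ^ 2 * C₀ ^ 2)) with hF
  -- The ideal signal is `√p / (‖D i‖ * l2norm b)`, where `b` is column `i` of the inverse of the
  -- scaled channel; its norm is at most `K * C₀`.
  refine eventually_le_instRate hp (c := 1 / (‖D i‖ * (K * C₀)))
    (by have := norm_pos_iff.2 (hD i); positivity) (fun ε hε => ?_) hε
  obtain ⟨C, hC⟩ := hS ε hε
  refine ⟨F * C, ?_⟩
  have hmδ : ∀ᶠ n in l, m n ≤ δ := hm.eventually (ge_mem_nhds hδ)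
  filter_upwards [hA, hC, hm0, hmδ] with n hA hC hm0 hmδ
  obtain ⟨hdet, hinv⟩ := hdecay (m n) hm0 hmδ G' hGM' hGc'
  have hm1 : m n ≤ 1 := hmδ.trans hδ1
  have hle : ∀ (B : Matrix (Fin K) (Fin K) ℂ) (N : ℝ), (∀ i k, ‖B i k‖ ≤ N) → N ≤ M' →
      ∀ i k, ‖channel (m n) B i k‖ ≤ M' := fun B N hB hN i k => by
    rw [norm_channel hm0.le]
    exact (mul_le_of_le_one_left (norm_nonneg _) (pow_le_one₀ hm0.le hm1)).trans
      ((hB i k).trans hN)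
  have key := norm_mul_effectivePrecoder_sub_le (H := channel (m n) G) (U := channel (m n) G')
    (D := D) (fun i k => by simp [channel, hG']; ring) hm0 hm1 hC₀.le hdet hinv
    (hle G M₁ hGM ((le_max_left _ _).trans (le_max_right _ _)))
    (hle G' M₂ hGM' ((le_max_right _ _).trans (le_max_right _ _))) (fun j => (hA j).1)
    (fun j i k => ((hA j).2 i k).trans (le_max_left _ _)) (fun j => (hC j).1)
    (fun j => (hC j).2) i
  have hDi := norm_pos_iff.2 (hD i)
  constructor
  · intro k hk
    have := key k
    rw [if_neg hk.symm, sub_zero, norm_mul] at this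
    rw [mul_assoc]
    exact le_of_mul_le_mul_left this hDi
  · have h1 := key i
    rw [if_pos rfl] at h1
    set b : Fin K → ℂ := fun r => (channel (m n) G')⁻¹ r i with hb
    have hb0 : 0 < l2norm b := by
      have := one_le_mul_l2norm_inv hdet
        (hle G' M₂ hGM' ((le_max_right _ _).trans (le_max_right _ _))) i
      by_contra h
      have h0 : l2norm b = 0 := le_antisymm (not_lt.1 h) (l2norm_nonneg _)
      rw [← hb, h0] at this
      norm_num at this
    have hbC : l2norm b ≤ K * C₀ := by
      refine (l2norm_le_sum b).trans ?_
      calc ∑ k, ‖b k‖ ≤ ∑ _k : Fin K, C₀ := Finset.sum_le_sum fun k _ =>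
            (hinv k i).trans (mul_le_of_le_one_right hC₀.le (pow_le_one₀ hm0.le hm1))
        _ = _ := by simp
    have h2 : √(p n) / l2norm b ≤ ‖D i‖ * ‖(channel (m n) G * effectivePrecoder (p n) (A n)) i i‖ +
        ‖D i‖ * (F * (C * p n ^ ε)) := by
      have h3 := norm_sub_norm_le (((√(p n) / l2norm b : ℝ) : ℂ))
        (D i * (channel (m n) G * effectivePrecoder (p n) (A n)) i i)
      rw [norm_sub_rev, norm_mul, Complex.norm_real, Real.norm_eq_abs, abs_of_nonneg
        (div_nonneg (Real.sqrt_nonneg _) hb0.le)] at h3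
      linarith
    have h4 : √(p n) / (K * C₀) ≤ √(p n) / l2norm b := by gcongr
    have h5 : 1 / (‖D i‖ * (K * C₀)) * √(p n) = (√(p n) / (K * C₀)) / ‖D i‖ := by
      field_simp
    rw [h5, sub_le_iff_le_add, div_le_iff₀ hDi]
    linarith

/-! ### Expected rates -/

/-- Sufficient conditions for the multiplexing gain one. -/
theorem hasMG_one {Ω : Type*} [MeasurableSpace Ω] {ν : Measure Ω} [IsProbabilityMeasure ν] {K : ℕ}
    {H T : ℝ → Ω → Matrix (Fin K) (Fin K) ℂ} {i : Fin K}
    (hmeas : ∀ P, Measurable fun ω => instRate (H P ω) (T P ω) i) {Z : Ω → ℝ}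
    (hZ : Integrable Z ν)
    (hub : ∀ᶠ P in atTop, ∀ᵐ ω ∂ν, instRate (H P ω) (T P ω) i ≤ Real.logb 2 P + Z ω)
    (hlow : ∀ p : ℕ → ℝ, Tendsto p atTop atTop → ∃ φ : ℕ → ℕ, Tendsto φ atTop atTop ∧
      ∀ᵐ ω ∂ν, ∀ ε : ℝ, 0 < ε → ∀ᶠ n in atTop, (1 - ε) * Real.logb 2 (p (φ n)) ≤
        instRate (H (p (φ n)) ω) (T (p (φ n)) ω) i) :
    HasMG ν H T i 1 := by
  -- It suffices that each sequence of powers has a subsequence with the right limit. This leaves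
  -- room for Borel–Cantelli, which needs sparse powers.
  refine tendsto_of_subseq_tendsto fun p hp => ?_
  obtain ⟨φ, hφ, hlow⟩ := hlow p hp
  refine ⟨φ, ?_⟩
  have hq : Tendsto (fun n => p (φ n)) atTop atTop := hp.comp hφ
  have hlog : Tendsto (fun n => Real.logb 2 (p (φ n))) atTop atTop :=
    (Real.tendsto_logb_atTop one_lt_two).comp hq
  have hub' : ∀ᶠ n in atTop, ∀ᵐ ω ∂ν, instRate (H (p (φ n)) ω) (T (p (φ n)) ω) i ≤
      Real.logb 2 (p (φ n)) + Z ω := hq.eventually hub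
  have hub'' : ∀ᵐ ω ∂ν, ∀ᶠ n in atTop, instRate (H (p (φ n)) ω) (T (p (φ n)) ω) i ≤
      Real.logb 2 (p (φ n)) + Z ω := by
    obtain ⟨N, hN⟩ := eventually_atTop.1 hub'
    have : ∀ᵐ ω ∂ν, ∀ n, N ≤ n → instRate (H (p (φ n)) ω) (T (p (φ n)) ω) i ≤
        Real.logb 2 (p (φ n)) + Z ω :=
      ae_all_iff.2 fun n => by
        by_cases h : N ≤ n
        · filter_upwards [hN n h] with ω hω _ using hω
        · exact Eventually.of_forall fun _ h' => absurd h' h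
    filter_upwards [this] with ω hω
    exact eventually_atTop.2 ⟨N, hω⟩
  have hdct : Tendsto (fun n => ∫ ω, instRate (H (p (φ n)) ω) (T (p (φ n)) ω) i /
      Real.logb 2 (p (φ n)) ∂ν) atTop (𝓝 (∫ _, (1 : ℝ) ∂ν)) := by
    refine tendsto_integral_filter_of_dominated_convergence (fun ω => 1 + |Z ω|) ?_ ?_ ?_ ?_
    · exact Eventually.of_forall fun n => ((hmeas _).div_const _).aestronglyMeasurable
    · filter_upwards [hub', hlog.eventually_ge_atTop 1] with n hn hn1
      filter_upwards [hn] with ω hω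
      have h0 : 0 < Real.logb 2 (p (φ n)) := by linarith
      rw [Real.norm_eq_abs, abs_of_nonneg (div_nonneg (instRate_nonneg _ _ _) h0.le),
        div_le_iff₀ h0]
      nlinarith [le_abs_self (Z ω), abs_nonneg (Z ω)]
    · exact (integrable_const _).add hZ.abs
    · filter_upwards [hlow, hub''] with ω hl hu
      refine tendsto_order.2 ⟨fun a ha => ?_, fun a ha => ?_⟩
      · filter_upwards [hl ((1 - a) / 2) (by linarith), hlog.eventually_ge_atTop 1] with n hn hn1
        rw [lt_div_iff₀ (by linarith)]
        nlinarith
      · filter_upwards [hu, hlog.eventually_ge_atTop 1,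
          hlog.eventually_gt_atTop (|Z ω| / (a - 1))] with n hn hn1 hn2
        rw [div_lt_iff₀ (by linarith)] at hn2
        rw [div_lt_iff₀ (by linarith)]
        nlinarith [le_abs_self (Z ω)]
  simp only [integral_const, probReal_univ, smul_eq_mul, mul_one] at hdct
  refine hdct.congr fun n => ?_
  rw [integral_div]
  rfl

/-! ### The complex Gaussian law -/

theorem measurable_complex_mk : Measurable fun p : ℝ × ℝ => (⟨p.1, p.2⟩ : ℂ) :=
  Complex.measurableEquivRealProd.symm.measurable

instance : IsProbabilityMeasure stdComplexGaussian :=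
  Measure.isProbabilityMeasure_map measurable_complex_mk.aemeasurable

theorem stdComplexGaussian_singleton (z : ℂ) : stdComplexGaussian {z} = 0 := by
  have : NullSingletonClass (gaussianReal 0 (1 / 2)) :=
    nullSingletonClass_gaussianReal (by norm_num)
  rw [stdComplexGaussian, Measure.map_apply measurable_complex_mk (measurableSet_singleton _)]
  refine measure_mono_null (t := {z.re} ×ˢ Set.univ) ?_ ?_
  · rintro ⟨x, y⟩ h
    have h' : (⟨x, y⟩ : ℂ) = z := h
    simp [← h']
  · rw [Measure.prod_prod, measure_singleton, zero_mul]

theorem integrable_norm_sq_stdComplexGaussian :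
    Integrable (fun z : ℂ => ‖z‖ ^ 2) stdComplexGaussian := by
  rw [stdComplexGaussian, integrable_map_measure (by fun_prop) measurable_complex_mk.aemeasurable]
  have h : Integrable (fun x : ℝ => x ^ 2) (gaussianReal 0 (1 / 2)) :=
    (memLp_id_gaussianReal 2).integrable_sq
  refine ((h.comp_fst (gaussianReal 0 (1 / 2))).add
    (h.comp_snd (gaussianReal 0 (1 / 2)))).congr (Eventually.of_forall fun p => ?_)
  simp only [Function.comp, Pi.add_apply, Complex.sq_norm, Complex.normSq_mk]
  ring

section Rayleigh

variable {Ω : Type*} [MeasurableSpace Ω] {ν : Measure Ω} {K : ℕ}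
  {G : Ω → Matrix (Fin K) (Fin K) ℂ}

theorem IsRayleigh.ae_ne_zero (hG : IsRayleigh ν G) : ∀ᵐ ω ∂ν, ∀ i k, G ω i k ≠ 0 := by
  rw [ae_all_iff]; intro i
  rw [ae_all_iff]; intro k
  have h : ∀ᵐ z ∂(ν.map fun ω => G ω i k), z ≠ 0 := by
    rw [hG.2.2 i k, ae_iff]
    simpa using stdComplexGaussian_singleton 0
  exact ae_of_ae_map (hG.1 i k).aemeasurable h

theorem IsRayleigh.integrable_norm_sq (hG : IsRayleigh ν G) (i k : Fin K) :
    Integrable (fun ω => ‖G ω i k‖ ^ 2) ν := by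
  have h := integrable_norm_sq_stdComplexGaussian
  rw [← hG.2.2 i k, integrable_map_measure (by fun_prop) (hG.1 i k).aemeasurable] at h
  exact h

end Rayleigh

/-! ### Measurability -/

section Measurability

variable {Ω : Type*} [MeasurableSpace Ω] {K : ℕ}

theorem measurable_l2norm : Measurable (l2norm : (Fin K → ℂ) → ℝ) := by
  have : (l2norm : (Fin K → ℂ) → ℝ) = fun v => √(∑ k, ‖v k‖ ^ 2) := by
    funext v
    rw [← l2norm_sq, Real.sqrt_sq (l2norm_nonneg v)]
  rw [this]
  fun_prop

theorem measurable_det {A : Ω → Matrix (Fin K) (Fin K) ℂ}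
    (hA : ∀ i k, Measurable fun ω => A ω i k) : Measurable fun ω => (A ω).det := by
  simp only [Matrix.det_apply]
  fun_prop

/-- By Cramer's rule an entry of the inverse is a quotient of determinants, also for singular
matrices, with the convention that the inverse of zero is zero. -/
theorem measurable_inv_apply {A : Ω → Matrix (Fin K) (Fin K) ℂ}
    (hA : ∀ i k, Measurable fun ω => A ω i k) (i k : Fin K) :
    Measurable fun ω => (A ω)⁻¹ i k := by
  have : (fun ω => (A ω)⁻¹ i k) =
      fun ω => ((A ω).det)⁻¹ * ((A ω).updateRow k (Pi.single i 1)).det := by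
    funext ω
    rw [Matrix.inv_def, Matrix.smul_apply, Matrix.adjugate_apply, Ring.inverse_eq_inv', smul_eq_mul]
  rw [this]
  refine (measurable_det hA).inv.mul (measurable_det fun r s => ?_)
  by_cases h : r = k
  · subst h
    simp
  · simpa [Matrix.updateRow_ne h] using hA r s

theorem measurable_effectivePrecoder (P : ℝ) {A : Ω → Fin K → Matrix (Fin K) (Fin K) ℂ}
    (hA : ∀ j i k, Measurable fun ω => A ω j i k) (j i : Fin K) :
    Measurable fun ω => effectivePrecoder P (A ω) j i := by
  simp only [effectivePrecoder, Matrix.of_apply, zfBeam]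
  have h1 : Measurable fun ω => l2norm fun m => (A ω j)⁻¹ m i :=
    measurable_l2norm.comp (measurable_pi_lambda _ fun m => measurable_inv_apply (hA j) m i)
  exact (Complex.measurable_ofReal.comp (h1.const_div _)).mul (measurable_inv_apply (hA j) j i)

theorem measurable_instRate {H T : Ω → Matrix (Fin K) (Fin K) ℂ}
    (hH : ∀ i k, Measurable fun ω => H ω i k) (hT : ∀ i k, Measurable fun ω => T ω i k)
    (i : Fin K) : Measurable fun ω => instRate (H ω) (T ω) i := by
  have hHT : ∀ l, Measurable fun ω => (H ω * T ω) i l := fun l => by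
    simp only [Matrix.mul_apply]
    fun_prop
  have hsq : ∀ l, Measurable fun ω => ‖(H ω * T ω) i l‖ ^ 2 := fun l => (hHT l).norm.pow_const 2
  exact (Real.measurable_log.comp (((hsq i).div ((Finset.measurable_sum _
    fun l _ => hsq l).const_add 1)).const_add 1)).div_const _

theorem measurable_channel (μ : ℝ) {G : Ω → Matrix (Fin K) (Fin K) ℂ}
    (hG : ∀ i k, Measurable fun ω => G ω i k) (i k : Fin K) :
    Measurable fun ω => channel μ (G ω) i k := by
  simp only [channel, Matrix.of_apply]
  exact (hG i k).const_mul _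

end Measurability

/-! ### Upper bounds and the maximal multiplexing gain -/

/-- Drop the interference, bound the signal by Cauchy–Schwarz and use `log (1 + x) ≤ x`. The
remainder does not depend on `P` and is integrable under Rayleigh fading, so it serves both for
domination and for the converse. -/
theorem instRate_channel_le {K : ℕ} {μ P : ℝ} (hμ : 0 ≤ μ) (hμ1 : μ ≤ 1) (hP : 1 ≤ P)
    {G T : Matrix (Fin K) (Fin K) ℂ} {i : Fin K} (hT : ∀ k, ‖T k i‖ ≤ √P) :
    instRate (channel μ G) T i ≤ Real.logb 2 P + K * (∑ k, ‖G i k‖ ^ 2) / Real.log 2 := by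
  have hP0 : 0 < P := by linarith
  set S := ∑ k, ‖G i k‖ ^ 2 with hS
  have hS0 : 0 ≤ S := Finset.sum_nonneg fun _ _ => sq_nonneg _
  have h1 : ‖(channel μ G * T) i i‖ ≤ √P * ∑ k, ‖G i k‖ := by
    rw [Matrix.mul_apply, Finset.mul_sum]
    refine (norm_sum_le _ _).trans (Finset.sum_le_sum fun k _ => ?_)
    rw [norm_mul, norm_channel hμ, mul_comm]
    gcongr
    · exact hT k
    · exact mul_le_of_le_one_left (norm_nonneg _) (pow_le_one₀ hμ hμ1)
  have h2 : ‖(channel μ G * T) i i‖ ^ 2 ≤ P * (K * S) := by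
    calc _ ≤ (√P * ∑ k, ‖G i k‖) ^ 2 := by gcongr
      _ = P * (∑ k, ‖G i k‖) ^ 2 := by rw [mul_pow, Real.sq_sqrt hP0.le]
      _ ≤ P * (K * S) := by
          gcongr
          simpa using sq_sum_le_card_mul_sum_sq (s := Finset.univ) (f := fun k => ‖G i k‖)
  have hI : 0 ≤ ∑ l ∈ Finset.univ.erase i, ‖(channel μ G * T) i l‖ ^ 2 :=
    Finset.sum_nonneg fun _ _ => sq_nonneg _
  rw [instRate]
  generalize ∑ l ∈ Finset.univ.erase i, ‖(channel μ G * T) i l‖ ^ 2 = I at hI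
  have h3 : ‖(channel μ G * T) i i‖ ^ 2 / (1 + I) ≤ P * (K * S) :=
    (div_le_self (sq_nonneg _) (by linarith)).trans h2
  have hq : 0 ≤ ‖(channel μ G * T) i i‖ ^ 2 / (1 + I) := div_nonneg (sq_nonneg _) (by linarith)
  have hKS : 0 ≤ K * S := by positivity
  calc _ ≤ Real.logb 2 (P * (1 + K * S)) :=
        Real.logb_le_logb_of_le one_lt_two (by linarith) (by nlinarith)
    _ = Real.logb 2 P + Real.logb 2 (1 + K * S) :=
        Real.logb_mul hP0.ne' (by linarith : (0 : ℝ) < 1 + K * S).ne'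
    _ ≤ _ := by
        gcongr
        rw [Real.logb]
        gcongr
        linarith [Real.log_le_sub_one_of_pos (by linarith : (0 : ℝ) < 1 + K * S)]

theorem le_one_of_mem_achievableMG {Ω : Type*} [MeasurableSpace Ω] {ν : Measure Ω}
    [IsProbabilityMeasure ν] {K : ℕ} {G : Ω → Matrix (Fin K) (Fin K) ℂ} (hG : IsRayleigh ν G)
    {μ : ℝ → ℝ} (hμ : ∀ᶠ P in atTop, 0 < μ P) (hμ0 : Tendsto μ atTop (𝓝 0)) {i : Fin K} {m : ℝ}
    (hm : m ∈ achievableMG ν (fun P ω => channel (μ P) (G ω)) i) : m ≤ 1 := by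
  obtain ⟨T, -, hTP, hTm⟩ := hm
  set Z : Ω → ℝ := fun ω => K * (∑ k, ‖G ω i k‖ ^ 2) / Real.log 2 with hZdef
  have hZ : Integrable Z ν :=
    ((integrable_finsetSum _ fun k _ => hG.integrable_norm_sq i k).const_mul _).div_const _
  have hlog : Tendsto (Real.logb 2) atTop atTop := Real.tendsto_logb_atTop one_lt_two
  have hlim : Tendsto (fun P => 1 + (∫ ω, Z ω ∂ν) / Real.logb 2 P) atTop (𝓝 (1 + 0)) :=
    tendsto_const_nhds.add (hlog.const_div_atTop _)
  rw [add_zero] at hlim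
  refine le_of_tendsto_of_tendsto hTm hlim ?_
  filter_upwards [hμ, hμ0.eventually (ge_mem_nhds one_pos), eventually_ge_atTop 1,
    hlog.eventually_ge_atTop 1] with P hP0 hP1 hP hPl
  have hle : avgRate ν (fun ω => channel (μ P) (G ω)) (T P) i ≤
      ∫ ω, (Real.logb 2 P + Z ω) ∂ν := by
    refine integral_mono_of_nonneg (Eventually.of_forall fun _ => instRate_nonneg _ _ _)
      ((integrable_const _).add hZ) ?_
    filter_upwards [hTP P (by linarith)] with ω hω
    refine instRate_channel_le hP0.le hP1 hP fun k => ?_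
    refine (norm_le_l2norm (fun k => T P ω k i) k).trans ?_
    rw [← Real.sqrt_sq (l2norm_nonneg fun k => T P ω k i), hω i]
  rw [integral_add (integrable_const _) hZ, integral_const, probReal_univ, one_smul] at hle
  have h0 : 0 < Real.logb 2 P := by linarith
  rw [div_le_iff₀ h0, add_mul, div_mul_cancel₀ _ h0.ne', one_mul]
  exact hle

theorem hasMG_one_of_lower {Ω : Type*} [MeasurableSpace Ω] {ν : Measure Ω}
    [IsProbabilityMeasure ν] {K : ℕ} {G : Ω → Matrix (Fin K) (Fin K) ℂ} (hG : IsRayleigh ν G)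
    {μ : ℝ → ℝ} (hμ : ∀ᶠ P in atTop, 0 < μ P) (hμ0 : Tendsto μ atTop (𝓝 0))
    {T : ℝ → Ω → Matrix (Fin K) (Fin K) ℂ} (hTmeas : ∀ P k l, Measurable fun ω => T P ω k l)
    (hTle : ∀ P ω k l, ‖T P ω k l‖ ≤ √P) {i : Fin K}
    (hlow : ∀ p : ℕ → ℝ, Tendsto p atTop atTop → ∃ φ : ℕ → ℕ, Tendsto φ atTop atTop ∧
      ∀ᵐ ω ∂ν, ∀ ε : ℝ, 0 < ε → ∀ᶠ n in atTop, (1 - ε) * Real.logb 2 (p (φ n)) ≤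
        instRate (channel (μ (p (φ n))) (G ω)) (T (p (φ n)) ω) i) :
    HasMG ν (fun P ω => channel (μ P) (G ω)) T i 1 := by
  refine hasMG_one (fun P => measurable_instRate (measurable_channel _ hG.1) (hTmeas P) i)
    (Z := fun ω => K * (∑ k, ‖G ω i k‖ ^ 2) / Real.log 2)
    (((integrable_finsetSum _ fun k _ => hG.integrable_norm_sq i k).const_mul _).div_const _)
    ?_ hlow
  filter_upwards [hμ, hμ0.eventually (ge_mem_nhds one_pos), eventually_ge_atTop 1] with P hP0 hP1 hP
  exact Eventually.of_forall fun ω => instRate_channel_le hP0.le hP1 hP fun k => hTle P ω k i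

theorem l2norm_zfBeam_sq {K : ℕ} {P : ℝ} (hP : 0 ≤ P) {A : Matrix (Fin K) (Fin K) ℂ}
    (hA : A.det ≠ 0) (i : Fin K) : l2norm (zfBeam P A i) ^ 2 = P := by
  have hA' : IsUnit A.det := isUnit_iff_ne_zero.2 hA
  have h0 : l2norm (fun m => A⁻¹ m i) ≠ 0 := by
    intro h
    have h1 : (A * A⁻¹) i i = 1 := by rw [Matrix.mul_nonsing_inv _ hA']; simp
    rw [Matrix.mul_apply] at h1
    simp [l2norm_eq_zero.1 h] at h1
  have h2 : 0 ≤ √P / l2norm (fun m => A⁻¹ m i) := div_nonneg (Real.sqrt_nonneg _) (l2norm_nonneg _)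
  have : l2norm (zfBeam P A i) = √P := by
    unfold zfBeam
    rw [l2norm_smul, Complex.norm_real, Real.norm_eq_abs, abs_of_nonneg h2, div_mul_cancel₀ _ h0]
  rw [this, Real.sq_sqrt hP]

/-- Zero forcing with perfect channel knowledge shows that the multiplexing gain one is achievable
under the power constraint. -/
theorem one_mem_achievableMG {Ω : Type*} [MeasurableSpace Ω] {ν : Measure Ω}
    [IsProbabilityMeasure ν] {K : ℕ} {G : Ω → Matrix (Fin K) (Fin K) ℂ} (hG : IsRayleigh ν G)
    {μ : ℝ → ℝ} (hμ : ∀ᶠ P in atTop, 0 < μ P) (hμ0 : Tendsto μ atTop (𝓝 0)) (i : Fin K) :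
    (1 : ℝ) ∈ achievableMG ν (fun P ω => channel (μ P) (G ω)) i := by
  classical
  -- For a singular channel the inverse is zero by convention and zero forcing would violate the
  -- power constraint; a multiple of the identity takes its place.
  set T : ℝ → Ω → Matrix (Fin K) (Fin K) ℂ := fun P ω =>
    if (channel (μ P) (G ω)).det = 0 then (√P : ℂ) • (1 : Matrix (Fin K) (Fin K) ℂ)
    else effectivePrecoder P fun _ => channel (μ P) (G ω) with hT
  have hTmeas : ∀ P k l, Measurable fun ω => T P ω k l := by
    intro P k l
    have h : (fun ω => T P ω k l) = fun ω => if (channel (μ P) (G ω)).det = 0 then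
        ((√P : ℂ) • (1 : Matrix (Fin K) (Fin K) ℂ)) k l
        else effectivePrecoder P (fun _ => channel (μ P) (G ω)) k l := by
      funext ω
      simp only [hT]
      split_ifs <;> rfl
    rw [h]
    exact Measurable.ite (measurable_det (measurable_channel _ hG.1) (measurableSet_singleton 0))
      measurable_const (measurable_effectivePrecoder P (fun _ => measurable_channel _ hG.1) k l)
  have hTnorm : ∀ P, 0 < P → ∀ ω l, l2norm (fun k => T P ω k l) ^ 2 = P := by
    intro P hP ω l
    simp only [hT]
    split_ifs with h
    · rw [l2norm_sq, Finset.sum_eq_single l]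
      · simp [Real.sq_sqrt hP.le]
      · intro k _ hk
        simp [Matrix.one_apply_ne hk]
      · simp
    · exact l2norm_zfBeam_sq hP.le h l
  refine ⟨T, hTmeas, fun P hP => Eventually.of_forall (hTnorm P hP), ?_⟩
  refine hasMG_one_of_lower hG hμ hμ0 hTmeas (fun P ω k l => ?_) fun p hp =>
    ⟨id, tendsto_id, ?_⟩
  · simp only [hT]
    split_ifs with h
    · rw [Matrix.smul_apply, Matrix.one_apply]
      split_ifs <;> simp [abs_of_nonneg, Real.sqrt_nonneg]
    · exact norm_zfBeam_le P _ l k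
  · filter_upwards [hG.ae_ne_zero] with ω hω ε hε
    have hdiag : ∀ i, G ω i i ≠ 0 := fun i => hω i i
    obtain ⟨M, hM, c, hc, hGM, hGc⟩ := exists_bounds_of_diag_ne_zero (G ω) hdiag
    obtain ⟨C₀, hC₀, δ, hδ, hδ1, hdecay⟩ := channel_inv_decay K hM hc
    have hev : ∀ᶠ P in atTop, 0 < μ P ∧ μ P ≤ δ := hμ.and (hμ0.eventually (ge_mem_nhds hδ))
    have hone : (Matrix.of fun i k => (1 : ℂ) * G ω i k) = G ω := by ext; simp
    have hlow := eventually_le_instRate_effectivePrecoder (l := atTop) (p := id) (m := μ)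
      tendsto_id hμ hμ0 hdiag (D := fun _ => 1) (fun _ => one_ne_zero)
      (A := fun P _ => channel (μ P) (G ω)) (M := M)
      (hev.mono fun P hP j => ⟨(hdecay _ hP.1 hP.2 _ hGM hGc).1, fun i k => by
        rw [norm_channel hP.1.le]
        exact (mul_le_of_le_one_left (norm_nonneg _)
          (pow_le_one₀ hP.1.le (hP.2.trans hδ1))).trans (hGM i k)⟩)
      (fun ε _ => ⟨0, Eventually.of_forall fun P j => by rw [hone]; simp⟩) i hε
    have hlow' : ∀ᶠ P in atTop, (1 - ε) * Real.logb 2 P ≤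
        instRate (channel (μ P) (G ω)) (T P ω) i := by
      filter_upwards [hlow, hev] with P h1 h2
      have hd : (channel (μ P) (G ω)).det ≠ 0 :=
        isUnit_iff_ne_zero.1 (hdecay _ h2.1 h2.2 _ hGM hGc).1
      simp only [hT, if_neg hd]
      exact h1
    exact hp.eventually hlow'

/-- Leaves each quantization scheme with a single task: an almost sure lower bound on the rate along
a subsequence. -/
theorem achievesMaximalMG_of_lower {Ω : Type*} [MeasurableSpace Ω] {ν : Measure Ω}
    [IsProbabilityMeasure ν] {K : ℕ} {G : Ω → Matrix (Fin K) (Fin K) ℂ} (hG : IsRayleigh ν G)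
    {μ : ℝ → ℝ} (hμ : ∀ᶠ P in atTop, 0 < μ P) (hμ0 : Tendsto μ atTop (𝓝 0))
    {T : ℝ → Ω → Matrix (Fin K) (Fin K) ℂ} (hTmeas : ∀ P k l, Measurable fun ω => T P ω k l)
    (hTle : ∀ P ω k l, ‖T P ω k l‖ ≤ √P)
    (hlow : ∀ p : ℕ → ℝ, Tendsto p atTop atTop → ∃ φ : ℕ → ℕ, Tendsto φ atTop atTop ∧
      ∀ᵐ ω ∂ν, ∀ i, ∀ ε : ℝ, 0 < ε → ∀ᶠ n in atTop, (1 - ε) * Real.logb 2 (p (φ n)) ≤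
        instRate (channel (μ (p (φ n))) (G ω)) (T (p (φ n)) ω) i) :
    AchievesMaximalMG ν (fun P ω => channel (μ P) (G ω)) T := by
  refine fun i => ⟨hasMG_one_of_lower hG hμ hμ0 hTmeas hTle fun p hp => ?_,
    one_mem_achievableMG hG hμ hμ0 i, fun m hm => le_one_of_mem_achievableMG hG hμ hμ0 hm⟩
  obtain ⟨φ, hφ, h⟩ := hlow p hp
  exact ⟨φ, hφ, h.mono fun ω hω => hω i⟩

/-! ### Decay rates of the inverse channel -/

/-- Decay rates exist, so the statements about all of them are not vacuous. The bound by `μ ^ gap i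
j` is even stronger than required, since it corresponds to `θ = 1`. -/
theorem isInverseDecayRate_neg_log {Ω : Type*} [MeasurableSpace Ω] {ν : Measure Ω} {K : ℕ}
    {G : Ω → Matrix (Fin K) (Fin K) ℂ} (hG : IsRayleigh ν G)
    {μ : ℝ → ℝ} (hμ : ∀ᶠ P in atTop, 0 < μ P) (hμ0 : Tendsto μ atTop (𝓝 0)) :
    IsInverseDecayRate ν (fun P ω => channel (μ P) (G ω)) fun P => -Real.log (μ P) := by
  have hlt := hμ0.eventually (gt_mem_nhds one_pos)
  refine ⟨?_, ?_⟩
  · filter_upwards [hμ, hlt] with P h0 h1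
    exact neg_pos.2 (Real.log_neg h0 h1)
  · filter_upwards [hG.ae_ne_zero] with ω hω θ hθ hθ1
    obtain ⟨M, hM, c, hc, hGM, hGc⟩ := exists_bounds_of_diag_ne_zero (G ω) fun i => hω i i
    obtain ⟨C₀, hC₀, δ, hδ, hδ1, hdecay⟩ := channel_inv_decay K hM hc
    refine ⟨C₀, ?_⟩
    filter_upwards [hμ, hlt, hμ0.eventually (ge_mem_nhds hδ)] with P h0 h1 h2 i j
    refine ((hdecay _ h0 h2 _ hGM hGc).2 i j).trans ?_
    gcongr
    have e : μ P ^ gap i j = Real.exp (Real.log (μ P) * gap i j) := by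
      rw [mul_comm, Real.exp_nat_mul, Real.exp_log h0]
    rw [e, Real.exp_le_exp]
    gcongr
    nlinarith [Real.log_neg h0 h1]

/-- In the equation for entry `(i, k)` of `H * H⁻¹ = 1`, every term but those through `i` and `k` is
`O(μ ^ 2)`. The term through `k` is of exact order `μ`, because `H⁻¹ k k` is bounded below, and the
term through `i` must cancel it. -/
theorem channel_inv_neighbour_lower {K : ℕ} {G : Matrix (Fin K) (Fin K) ℂ} (hG : ∀ i k, G i k ≠ 0)
    {i k : Fin K} (hik : gap i k = 1) :
    ∃ c > 0, ∃ δ > 0, ∀ μ : ℝ, 0 < μ → μ ≤ δ → c * μ ≤ ‖(channel μ G)⁻¹ i k‖ := by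
  have hK : (0 : ℝ) < K := by exact_mod_cast i.pos
  obtain ⟨M, hM, c, hc, hGM, hGc⟩ := exists_bounds_of_diag_ne_zero G fun i => hG i i
  obtain ⟨C₀, hC₀, δ, hδ, hδ1, hdecay⟩ := channel_inv_decay K hM hc
  have hg := norm_pos_iff.2 (hG i k)
  set B := K * (M * C₀) with hB
  have hB0 : 0 < B := by positivity
  have hne : k ≠ i := by
    rintro rfl
    simp [gap_self] at hik
  -- The bound `1 / (2 * B)` gives `‖H⁻¹ k k‖ ≥ 1 / (2 * M)`; the last bound makes the quadratic
  -- remainder at most half of the main term.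
  refine ⟨‖G i k‖ / (4 * M ^ 2), by positivity,
    min δ (min (1 / (2 * B)) (‖G i k‖ / (4 * M * B))), by positivity, fun μ hμ0 hμ => ?_⟩
  have hμδ : μ ≤ δ := hμ.trans (min_le_left _ _)
  have hμ1 : μ ≤ 1 := hμδ.trans hδ1
  have hμB : μ * B ≤ 1 / 2 := by
    have := hμ.trans ((min_le_right _ _).trans (min_le_left _ _))
    rw [le_div_iff₀ (by positivity)] at this
    linarith
  have hμg : μ * (4 * M * B) ≤ ‖G i k‖ := by
    have := hμ.trans ((min_le_right _ _).trans (min_le_right _ _))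
    rwa [le_div_iff₀ (by positivity)] at this
  obtain ⟨hdet, hinv⟩ := hdecay μ hμ0 hμδ G hGM hGc
  set X := (channel μ G)⁻¹ with hX
  have hprod : ∀ r s, ∑ t, channel μ G r t * X t s = (1 : Matrix (Fin K) (Fin K) ℂ) r s := by
    intro r s
    rw [← Matrix.mul_nonsing_inv _ hdet, Matrix.mul_apply]
  have hterm : ∀ r s t, 2 ≤ gap r t + gap t s → ‖channel μ G r t * X t s‖ ≤ M * C₀ * μ ^ 2 := by
    intro r s t h
    rw [norm_mul, norm_channel hμ0.le]
    calc μ ^ gap r t * ‖G r t‖ * ‖X t s‖ ≤ μ ^ gap r t * M * (C₀ * μ ^ gap t s) := by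
          gcongr
          · exact hGM r t
          · exact hinv t s
      _ = M * C₀ * μ ^ (gap r t + gap t s) := by rw [pow_add]; ring
      _ ≤ _ := by
          gcongr ?_ * ?_
          exact pow_le_pow_of_le_one hμ0.le hμ1 h
  have hsum : ∀ (r s : Fin K) (A : Finset (Fin K)), (∀ t ∈ A, 2 ≤ gap r t + gap t s) →
      ‖∑ t ∈ A, channel μ G r t * X t s‖ ≤ B * μ ^ 2 := by
    intro r s A hA
    calc _ ≤ ∑ t ∈ A, M * C₀ * μ ^ 2 :=
          (norm_sum_le _ _).trans (Finset.sum_le_sum fun t ht => hterm r s t (hA t ht))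
      _ ≤ ∑ _t : Fin K, M * C₀ * μ ^ 2 :=
          Finset.sum_le_sum_of_subset_of_nonneg (Finset.subset_univ _) fun _ _ _ => by positivity
      _ = _ := by simp [hB]; ring
  have hkk : 1 / 2 ≤ M * ‖X k k‖ := by
    have h1 := hprod k k
    rw [Matrix.one_apply_eq, ← Finset.add_sum_erase _ _ (Finset.mem_univ k)] at h1
    have h2 := hsum k k (Finset.univ.erase k) fun t ht => by
      have := gap_pos (Finset.ne_of_mem_erase ht)
      rw [gap_comm k t]; omega
    have h3 : ‖channel μ G k k * X k k‖ ≤ M * ‖X k k‖ := by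
      rw [norm_mul, norm_channel hμ0.le, gap_self, pow_zero, one_mul]
      gcongr
      exact hGM k k
    have h4 : (1 : ℝ) ≤ ‖channel μ G k k * X k k‖ +
        ‖∑ t ∈ Finset.univ.erase k, channel μ G k t * X t k‖ := by
      calc (1 : ℝ) = ‖(1 : ℂ)‖ := by simp
        _ ≤ _ := by rw [← h1]; exact norm_add_le _ _
    nlinarith
  have h1 := hprod i k
  rw [Matrix.one_apply_ne hne.symm, ← Finset.add_sum_erase _ _ (Finset.mem_univ i),
    ← Finset.add_sum_erase _ _ (Finset.mem_erase.2 ⟨hne, Finset.mem_univ k⟩)] at h1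
  have h2 := hsum i k ((Finset.univ.erase i).erase k) fun t ht => by
    have e1 := gap_pos (Finset.ne_of_mem_erase ht)
    have e2 := gap_pos (Finset.ne_of_mem_erase (Finset.mem_of_mem_erase ht))
    rw [gap_comm i t]; omega
  have h3 : ‖channel μ G i k * X k k‖ ≤ ‖channel μ G i i * X i k‖ +
      ‖∑ t ∈ (Finset.univ.erase i).erase k, channel μ G i t * X t k‖ := by
    have : channel μ G i k * X k k = -(channel μ G i i * X i k +
        ∑ t ∈ (Finset.univ.erase i).erase k, channel μ G i t * X t k) := by
      linear_combination h1
    rw [this, norm_neg]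
    exact norm_add_le _ _
  have h4 : ‖channel μ G i i * X i k‖ ≤ M * ‖X i k‖ := by
    rw [norm_mul, norm_channel hμ0.le, gap_self, pow_zero, one_mul]
    gcongr
    exact hGM i i
  have h5 : ‖channel μ G i k * X k k‖ = μ * ‖G i k‖ * ‖X k k‖ := by
    rw [norm_mul, norm_channel hμ0.le, hik, pow_one]
  have h6 : μ * ‖G i k‖ * ‖X k k‖ ≤ M * ‖X i k‖ + B * μ ^ 2 := by linarith
  rw [div_mul_eq_mul_div, div_le_iff₀ (by positivity)]
  have h7 : μ * ‖G i k‖ * (1 / 2) ≤ M * (M * ‖X i k‖ + B * μ ^ 2) := by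
    calc μ * ‖G i k‖ * (1 / 2) ≤ μ * ‖G i k‖ * (M * ‖X k k‖) := by gcongr
      _ = M * (μ * ‖G i k‖ * ‖X k k‖) := by ring
      _ ≤ _ := by gcongr
  nlinarith

/-- A decay rate of the inverse channel cannot be much larger than `-log μ`. -/
theorem IsInverseDecayRate.eventually_le {Ω : Type*} [MeasurableSpace Ω] {ν : Measure Ω}
    [IsProbabilityMeasure ν] {K : ℕ} {G : Ω → Matrix (Fin K) (Fin K) ℂ} (hG : IsRayleigh ν G)
    {μ : ℝ → ℝ} (hμ : ∀ᶠ P in atTop, 0 < μ P) (hμ0 : Tendsto μ atTop (𝓝 0)) {γ : ℝ → ℝ}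
    (hγ : IsInverseDecayRate ν (fun P ω => channel (μ P) (G ω)) γ) :
    ∃ C > 0, ∀ᶠ P in atTop, ∀ d < K,
      Real.exp (-γ P) * (μ P / Real.exp (-γ P)) ^ d ≤ C := by
  rcases Nat.lt_or_ge K 2 with hK | hK
  · refine ⟨1, one_pos, ?_⟩
    filter_upwards [hγ.1] with P hP d hd
    obtain rfl : d = 0 := by omega
    simpa using hP.le
  -- With this choice `1 + θ * d ≥ d` for all `d < K`, so the single factor `exp (-γ P)` pays for
  -- the loss of `θ < 1` in all `d` factors.
  set θ : ℝ := 1 - 1 / K with hθ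
  have hK' : (2 : ℝ) ≤ K := by exact_mod_cast hK
  have hθ0 : 0 < θ := by
    rw [hθ, sub_pos, div_lt_one (by linarith)]; linarith
  have hθ1 : θ < 1 := by
    rw [hθ]; have : 0 < 1 / (K : ℝ) := by positivity
    linarith
  -- Both `μ` and `γ` are deterministic, so one good realization of the fading suffices.
  obtain ⟨ω, hω, hdec⟩ := (hG.ae_ne_zero.and hγ.2).exists
  obtain ⟨C, hC⟩ := hdec θ hθ0 hθ1
  have hgap : gap (⟨0, by omega⟩ : Fin K) ⟨1, by omega⟩ = 1 := by simp [gap]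
  obtain ⟨c, hc, δ, hδ, hlow⟩ := channel_inv_neighbour_lower hω hgap
  set C' := max (C / c) 1 with hC'
  have hC'1 : 1 ≤ C' := le_max_right _ _
  refine ⟨C' ^ K, by positivity, ?_⟩
  filter_upwards [hγ.1, hC, hμ, hμ0.eventually (ge_mem_nhds hδ)] with P hγP hCP h0 h1 d hd
  set q := Real.exp (-γ P) with hq
  have hq0 : 0 < q := Real.exp_pos _
  have hq1 : q ≤ 1 := by rw [hq]; simpa using hγP.le
  have hμq : μ P ≤ C' * q ^ θ := by
    have h2 := (hlow _ h0 h1).trans (hCP ⟨0, by omega⟩ ⟨1, by omega⟩)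
    rw [hgap] at h2
    have e : Real.exp (-(θ * γ P) * (1 : ℕ)) = q ^ θ := by
      rw [hq, ← Real.exp_mul]; congr 1; push_cast; ring
    rw [e] at h2
    calc μ P ≤ C / c * q ^ θ := by rw [div_mul_eq_mul_div, le_div_iff₀ hc]; linarith
      _ ≤ _ := by gcongr; exact le_max_left _ _
  have hpow : q * (q ^ θ) ^ d ≤ q ^ d := by
    have e : q * (q ^ θ) ^ d = q ^ (1 + θ * d) := by
      rw [Real.rpow_add hq0, Real.rpow_one, ← Real.rpow_natCast (q ^ θ), ← Real.rpow_mul hq0.le]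
    rw [e, ← Real.rpow_natCast q d]
    refine Real.rpow_le_rpow_of_exponent_ge hq0 hq1 ?_
    have hdK : (d : ℝ) ≤ K := by exact_mod_cast hd.le
    have : (d : ℝ) / K ≤ 1 := by rw [div_le_one (by linarith)]; exact hdK
    rw [hθ, sub_mul, one_mul, one_div_mul_eq_div]
    linarith
  rw [div_pow, ← mul_div_assoc, div_le_iff₀ (by positivity)]
  calc q * μ P ^ d ≤ q * (C' * q ^ θ) ^ d := by gcongr
    _ = C' ^ d * (q * (q ^ θ) ^ d) := by rw [mul_pow]; ring
    _ ≤ C' ^ K * q ^ d := by gcongr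

/-! ### Uniform scalar quantization -/

theorem abs_uniformQuant_sub_le {L : ℝ} (hL : 0 < L) (b : ℕ) {x : ℝ} (hx : |x| ≤ L) :
    |uniformQuant L b x - x| ≤ L / 2 ^ b := by
  obtain ⟨hx1, hx2⟩ := abs_le.1 hx
  have h2b : (0 : ℝ) < 2 ^ b := by positivity
  set Δ : ℝ := 2 * L / 2 ^ b with hΔ
  have hΔ0 : 0 < Δ := by positivity
  have hLΔ : L / 2 ^ b = Δ / 2 := by rw [hΔ]; ring
  have hΔL : 2 ^ b * Δ = 2 * L := by rw [hΔ]; field_simp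
  have hf0 : 0 ≤ ⌊(x + L) / Δ⌋ := Int.floor_nonneg.2 (div_nonneg (by linarith) hΔ0.le)
  rw [hLΔ, uniformQuant, ← hΔ]
  by_cases hf : ⌊(x + L) / Δ⌋ ≤ 2 ^ b - 1
  · rw [min_eq_left hf, max_eq_right hf0]
    have h1 := Int.floor_le ((x + L) / Δ)
    have h2 := Int.lt_floor_add_one ((x + L) / Δ)
    rw [le_div_iff₀ hΔ0] at h1
    rw [div_lt_iff₀ hΔ0] at h2
    rw [abs_le]
    constructor <;> nlinarith
  -- Within the range the index is clipped only at the right endpoint `x = L`, which lies half a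
  -- cell from the last midpoint.
  · have hf' : (2 ^ b : ℤ) ≤ ⌊(x + L) / Δ⌋ := by omega
    have h1 : ((2 ^ b : ℤ) : ℝ) ≤ (x + L) / Δ := Int.le_floor.1 hf'
    rw [le_div_iff₀ hΔ0] at h1
    push_cast at h1
    have hxL : x = L := by linarith
    have hp : (0 : ℤ) ≤ 2 ^ b - 1 := by
      have : (1 : ℤ) ≤ 2 ^ b := one_le_pow₀ (by norm_num)
      omega
    rw [min_eq_right (by omega), max_eq_right hp, hxL]
    push_cast
    rw [abs_le]
    constructor <;> nlinarith

/-- With at least one bit, zero is a boundary between cells, not a midpoint: `2 * n + 1` is odd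
whereas `2 ^ b` is even. -/
theorem uniformQuant_ne_zero {L : ℝ} (hL : 0 < L) {b : ℕ} (hb : b ≠ 0) (x : ℝ) :
    uniformQuant L b x ≠ 0 := by
  rw [uniformQuant]
  generalize (max 0 (min ⌊(x + L) / (2 * L / 2 ^ b)⌋ (2 ^ b - 1)) : ℤ) = n
  intro h
  have h2b : (0 : ℝ) < 2 ^ b := by positivity
  have h1 : (2 * (n : ℝ) + 1) = 2 ^ b := by
    field_simp at h
    rw [mul_zero, mul_eq_zero] at h
    rcases h with h | h <;> linarith
  have h2 : 2 * n + 1 = (2 ^ b : ℤ) := by exact_mod_cast h1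
  obtain ⟨m, rfl⟩ := Nat.exists_eq_succ_of_ne_zero hb
  rw [pow_succ] at h2
  omega

/-- The finitely many exceptional terms are absorbed into the constant. This makes the quantization
bounds uniform in the number of bits, which need not tend to infinity with `P`. -/
theorem exists_forall_le_mul_of_eventually_le {f g : ℕ → ℝ} (hg : ∀ n, 0 < g n)
    (h : ∀ᶠ n in atTop, f n ≤ g n) : ∃ C > 0, ∀ n, f n ≤ C * g n := by
  have hb : IsBoundedUnder (· ≤ ·) atTop fun n => f n / g n :=
    ⟨1, eventually_map.2 (h.mono fun n hn => (div_le_one (hg n)).2 hn)⟩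
  obtain ⟨C, hC⟩ := hb.bddAbove_range
  refine ⟨max C 1, by positivity, fun n => ?_⟩
  rw [← div_le_iff₀ (hg n)]
  exact le_max_of_le_left (hC ⟨n, rfl⟩)

theorem exists_pos_forall_le {ι : Type*} [Finite ι] (f : ι → ℝ) : ∃ M > 0, ∀ i, f i ≤ M := by
  obtain ⟨M, hM⟩ := (Set.finite_range f).bddAbove
  exact ⟨max M 1, by positivity, fun i => le_max_of_le_left (hM ⟨i, rfl⟩)⟩

/-- For a fixed input, overload occurs for only finitely many `b`, and subexponential growth means
`L b ≤ 2 ^ (η * b)` eventually. -/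
theorem exists_abs_uniformQuant_sub_le {L : ℕ → ℝ} (hL : IsAdmissibleRange L) (x : ℝ) {η : ℝ}
    (hη : 0 < η) :
    ∃ C > 0, ∀ b : ℕ, |uniformQuant (L b) b x - x| ≤ C * (2 : ℝ) ^ (-(1 - η) * b) := by
  refine exists_forall_le_mul_of_eventually_le (fun b => by positivity) ?_
  filter_upwards [hL.2.1.eventually_ge_atTop |x|,
    hL.2.2.eventually (gt_mem_nhds (mul_pos hη (Real.log_pos one_lt_two))),
    eventually_gt_atTop 0] with b hb1 hb2 hb
  have hb' : (0 : ℝ) < b := by exact_mod_cast hb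
  have hLb : L b ≤ (2 : ℝ) ^ (η * b) := by
    rw [div_lt_iff₀ hb'] at hb2
    rw [← Real.log_le_log_iff (hL.1 b) (by positivity), Real.log_rpow two_pos]
    linarith
  calc _ ≤ L b / 2 ^ b := abs_uniformQuant_sub_le (hL.1 b) b hb1
    _ ≤ (2 : ℝ) ^ (η * b) / 2 ^ b := by gcongr
    _ = _ := by
        rw [← Real.rpow_natCast 2 b, ← Real.rpow_sub two_pos]
        congr 1
        ring

theorem exists_norm_scalarQuant_sub_le {L : ℕ → ℝ} (hL : IsAdmissibleRange L) (a g : ℂ) {η : ℝ}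
    (hη : 0 < η) (hη1 : η < 1) :
    ∃ C > 0, ∀ n : ℕ, ‖scalarQuant L a n g - g‖ ≤ C * (2 : ℝ) ^ (-(1 - η) * n / 2) := by
  obtain ⟨C₁, hC₁, h₁⟩ := exists_abs_uniformQuant_sub_le hL g.re hη
  obtain ⟨C₂, hC₂, h₂⟩ := exists_abs_uniformQuant_sub_le hL g.im hη
  refine ⟨max ‖a - g‖ ((C₁ + C₂) * 2), by positivity, fun n => ?_⟩
  by_cases hn : n = 0
  · simp [scalarQuant, hn]
  -- The hypothesis `n ≤ 2 * b + 1` covers both `⌈n/2⌉` and `⌊n/2⌋`; rounding costs at most a factor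
  -- `2`.
  · have hpow : ∀ b : ℕ, n ≤ 2 * b + 1 →
        (2 : ℝ) ^ (-(1 - η) * b) ≤ 2 * (2 : ℝ) ^ (-(1 - η) * n / 2) := by
      intro b hb
      have hb' : (n : ℝ) ≤ 2 * b + 1 := by exact_mod_cast hb
      calc (2 : ℝ) ^ (-(1 - η) * b) ≤ (2 : ℝ) ^ (1 + -(1 - η) * n / 2) := by
            refine Real.rpow_le_rpow_of_exponent_le one_le_two ?_
            nlinarith
        _ = _ := by rw [Real.rpow_add two_pos, Real.rpow_one]
    calc ‖scalarQuant L a n g - g‖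
        ≤ |(scalarQuant L a n g - g).re| + |(scalarQuant L a n g - g).im| :=
          Complex.norm_le_abs_re_add_abs_im _
      _ ≤ C₁ * (2 : ℝ) ^ (-(1 - η) * ((n + 1) / 2 : ℕ)) +
          C₂ * (2 : ℝ) ^ (-(1 - η) * (n / 2 : ℕ)) := by
          rw [scalarQuant, if_neg hn, Complex.sub_re, Complex.sub_im]
          exact add_le_add (h₁ _) (h₂ _)
      _ ≤ C₁ * (2 * (2 : ℝ) ^ (-(1 - η) * n / 2)) + C₂ * (2 * (2 : ℝ) ^ (-(1 - η) * n / 2)) := by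
          gcongr
          · exact hpow _ (by omega)
          · exact hpow _ (by omega)
      _ = (C₁ + C₂) * 2 * (2 : ℝ) ^ (-(1 - η) * n / 2) := by ring
      _ ≤ _ := by gcongr; exact le_max_right _ _

theorem scalarQuant_ne_zero {L : ℕ → ℝ} (hL : IsAdmissibleRange L) {a : ℂ} (ha : a ≠ 0) (n : ℕ)
    (g : ℂ) : scalarQuant L a n g ≠ 0 := by
  rw [scalarQuant]
  split_ifs with hn
  · exact ha
  · intro h
    exact uniformQuant_ne_zero (hL.1 _) (by omega) g.re (congrArg Complex.re h)

theorem exists_norm_scalarQuant_le {L : ℕ → ℝ} (hL : IsAdmissibleRange L) (a g : ℂ) :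
    ∃ M > 0, ∀ n, ‖scalarQuant L a n g‖ ≤ M := by
  obtain ⟨C, hC, h⟩ := exists_norm_scalarQuant_sub_le hL a g (η := 1 / 2) (by norm_num)
    (by norm_num)
  refine ⟨C + ‖g‖, by positivity, fun n => ?_⟩
  have h1 : (2 : ℝ) ^ (-(1 - 1 / 2 : ℝ) * n / 2) ≤ 1 :=
    Real.rpow_le_one_of_one_le_of_nonpos one_le_two (by
      have : (0 : ℝ) ≤ n := n.cast_nonneg
      linarith)
  have h2 := norm_le_norm_sub_add (scalarQuant L a n g) g
  nlinarith [h n]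

/-- For many bits the output is close to `g ≠ 0`; for each of the finitely many other bit counts it
is nonzero. The diagonal of the estimate thus stays away from zero, as `channel_inv_decay` requires.
-/
theorem exists_le_norm_scalarQuant {L : ℕ → ℝ} (hL : IsAdmissibleRange L) {a g : ℂ} (ha : a ≠ 0)
    (hg : g ≠ 0) : ∃ c > 0, ∀ n, c ≤ ‖scalarQuant L a n g‖ := by
  obtain ⟨C, hC, h⟩ := exists_norm_scalarQuant_sub_le hL a g (η := 1 / 2) (by norm_num)
    (by norm_num)
  have hg' := norm_pos_iff.2 hg
  have hlim : Tendsto (fun n : ℕ => C * (2 : ℝ) ^ (-(1 - 1 / 2 : ℝ) * n / 2)) atTop (𝓝 (C * 0)) := by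
    refine Tendsto.const_mul _ ?_
    have h1 : Tendsto (fun n : ℕ => ((2 : ℝ) ^ (-(1 / 4) : ℝ)) ^ n) atTop (𝓝 0) :=
      tendsto_pow_atTop_nhds_zero_of_lt_one (by positivity)
        (Real.rpow_lt_one_of_one_lt_of_neg one_lt_two (by norm_num))
    refine h1.congr fun n => ?_
    rw [← Real.rpow_natCast, ← Real.rpow_mul zero_le_two]
    congr 1
    ring
  rw [mul_zero] at hlim
  obtain ⟨B, hB, hB'⟩ := exists_forall_le_mul_of_eventually_le (f := fun _ => ‖g‖ / 2)
    (g := fun n => ‖scalarQuant L a n g‖)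
    (fun n => norm_pos_iff.2 (scalarQuant_ne_zero hL ha n g)) (by
      filter_upwards [hlim.eventually (gt_mem_nhds (half_pos hg'))] with n hn
      have h1 := h n
      have h2 := norm_le_norm_sub_add g (scalarQuant L a n g)
      rw [norm_sub_rev] at h2
      linarith)
  exact ⟨‖g‖ / 2 / B, by positivity, fun n => by rw [div_le_iff₀ hB, mul_comm]; exact hB' n⟩

/-- Put `y = q * (μ / q) ^ d`. The prescribed `2 ^ n` is at least `(√P * μ ^ g / y) ^ 2`, so an
ideal error `2 ^ (-n / 2)` would be at most `y / (√P * μ ^ g)`. The exponent `1 - η` costs a further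
`(√P * μ ^ g) ^ η ≤ P ^ (η / 2)`. -/
theorem sqrt_mul_two_rpow_le {P μ q C η : ℝ} (hP : 0 < P) (hμ : 0 < μ) (hμ1 : μ ≤ 1) (hq : 0 < q)
    {d g n : ℕ} (hC : q * (μ / q) ^ d ≤ C) (hη : 0 < η) (hη1 : η < 1)
    (hn : P / q ^ 2 * (q ^ (2 * d) / μ ^ (2 * d)) * μ ^ (2 * g) ≤ 2 ^ n) :
    √P * (2 : ℝ) ^ (-(1 - η) * n / 2) * μ ^ g ≤ max C 1 * P ^ (η / 2) := by
  set y := q * (μ / q) ^ d with hy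
  have hy0 : 0 < y := by positivity
  set s := √P with hs
  have hs0 : 0 < s := Real.sqrt_pos.2 hP
  set w := μ ^ g with hw
  have hw0 : 0 < w := by positivity
  have hx : P / q ^ 2 * (q ^ (2 * d) / μ ^ (2 * d)) * μ ^ (2 * g) = (s * w / y) ^ 2 := by
    rw [hy, hw, div_pow, mul_pow, mul_pow, hs, Real.sq_sqrt hP.le]
    rw [div_pow, div_pow, ← pow_mul, ← pow_mul, ← pow_mul, mul_comm d 2, mul_comm g 2]
    field_simp
  rw [hx] at hn
  have h1 : (2 : ℝ) ^ (-(1 - η) * n / 2) ≤ (y / (s * w)) ^ (1 - η) := by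
    calc (2 : ℝ) ^ (-(1 - η) * n / 2) = ((2 : ℝ) ^ n) ^ (-(1 - η) / 2) := by
          rw [← Real.rpow_natCast, ← Real.rpow_mul zero_le_two]; congr 1; ring
      _ ≤ ((s * w / y) ^ 2) ^ (-(1 - η) / 2) :=
          Real.rpow_le_rpow_of_nonpos (by positivity) hn (by linarith)
      _ = (s * w / y) ^ (-(1 - η)) := by
          rw [← Real.rpow_natCast, ← Real.rpow_mul (by positivity)]; congr 1; push_cast; ring
      _ = _ := by
          rw [Real.rpow_neg (by positivity), ← Real.inv_rpow (by positivity), inv_div]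
  have h2 : s * (y / (s * w)) ^ (1 - η) * w = y ^ (1 - η) * s ^ η * w ^ η := by
    rw [Real.div_rpow hy0.le (by positivity), Real.mul_rpow hs0.le hw0.le, Real.rpow_sub hs0,
      Real.rpow_sub hw0, Real.rpow_one, Real.rpow_one]
    have := Real.rpow_pos_of_pos hs0 η
    have := Real.rpow_pos_of_pos hw0 η
    field_simp
  calc s * (2 : ℝ) ^ (-(1 - η) * n / 2) * w ≤ s * (y / (s * w)) ^ (1 - η) * w := by gcongr
    _ = y ^ (1 - η) * s ^ η * w ^ η := h2
    _ ≤ max C 1 * s ^ η * 1 := by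
        gcongr
        · calc y ^ (1 - η) ≤ (max C 1) ^ (1 - η) := by
                gcongr
                exact hC.trans (le_max_left _ _)
            _ ≤ (max C 1) ^ (1 : ℝ) :=
                Real.rpow_le_rpow_of_exponent_le (le_max_right _ _) (by linarith)
            _ = max C 1 := Real.rpow_one _
        · exact Real.rpow_le_one hw0.le (pow_le_one₀ hμ.le hμ1) hη.le
    _ = _ := by
        rw [mul_one, hs, Real.sqrt_eq_rpow, ← Real.rpow_mul hP.le]
        congr 2
        ring

theorem le_two_pow_ceil_max_logb {x : ℝ} (hx : 0 < x) :
    x ≤ 2 ^ ⌈max (Real.logb 2 x) 0⌉₊ := by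
  have h : Real.logb 2 x ≤ (⌈max (Real.logb 2 x) 0⌉₊ : ℝ) :=
    (le_max_left _ _).trans (Nat.le_ceil _)
  rwa [Real.logb_le_iff_le_rpow one_lt_two hx, Real.rpow_natCast] at h

/-- Deterministic in the fading: all constants may depend on `G` but not on `P`. The estimate has
the same channel structure, so its inverse decays by `channel_inv_decay`. -/
theorem eventually_le_instRate_scalarPrecoder {K : ℕ} {G : Matrix (Fin K) (Fin K) ℂ}
    (hG : ∀ i, G i i ≠ 0) {μ μ' : ℝ → ℝ} (hμ : ∀ᶠ P in atTop, 0 < μ P)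
    (hμ0 : Tendsto μ atTop (𝓝 0)) (hμ' : ∀ P, 0 < μ' P) {Cy : ℝ}
    (hCy : ∀ᶠ P in atTop, ∀ d < K, μ' P * (μ P / μ' P) ^ d ≤ Cy) {L : ℕ → ℝ}
    (hL : IsAdmissibleRange L) {a : Fin K → Matrix (Fin K) (Fin K) ℂ} (ha : ∀ j i, a j i i ≠ 0)
    (i : Fin K) {ε : ℝ} (hε : 0 < ε) :
    ∀ᶠ P in atTop, (1 - ε) * Real.logb 2 P ≤ instRate (channel (μ P) G)
      (effectivePrecoder P fun j => channel (μ P) <| Matrix.of fun i k =>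
        scalarQuant L (a j i k) ⌈scalarBits P (μ P) (μ' P) i k j⌉₊ (G i k)) i := by
  have hbound : ∃ M > 0, ∀ (j i k : Fin K) n, ‖scalarQuant L (a j i k) n (G i k)‖ ≤ M := by
    choose f hf hf' using fun q : Fin K × Fin K × Fin K =>
      exists_norm_scalarQuant_le hL (a q.1 q.2.1 q.2.2) (G q.2.1 q.2.2)
    obtain ⟨M, hM, h⟩ := exists_pos_forall_le f
    exact ⟨M, hM, fun j i k n => (hf' (j, i, k) n).trans (h _)⟩
  have hlower : ∃ c > 0, ∀ (j i : Fin K) n, c ≤ ‖scalarQuant L (a j i i) n (G i i)‖ := by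
    choose f hf hf' using fun q : Fin K × Fin K =>
      exists_le_norm_scalarQuant hL (ha q.1 q.2) (hG q.2)
    obtain ⟨M, hM, h⟩ := exists_pos_forall_le fun q => (f q)⁻¹
    exact ⟨M⁻¹, by positivity, fun j i n =>
      (inv_le_of_inv_le₀ (hf (j, i)) (h (j, i))).trans (hf' (j, i) n)⟩
  obtain ⟨M, hM, hGM⟩ := hbound
  obtain ⟨c, hc, hGc⟩ := hlower
  obtain ⟨C₀, hC₀, δ, hδ, hδ1, hdecay⟩ := channel_inv_decay K hM hc
  have hev : ∀ᶠ P in atTop, 0 < μ P ∧ μ P ≤ δ := hμ.and (hμ0.eventually (ge_mem_nhds hδ))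
  refine eventually_le_instRate_effectivePrecoder (l := atTop) (p := id) (m := μ)
    tendsto_id hμ hμ0 hG (D := fun _ => 1) (fun _ => one_ne_zero) (M := M) ?_ ?_ i hε
  · filter_upwards [hev] with P hP j
    refine ⟨(hdecay _ hP.1 hP.2 _ (fun i k => hGM j i k _) fun i => hGc j i _).1, fun i k => ?_⟩
    rw [norm_channel hP.1.le]
    exact (mul_le_of_le_one_left (norm_nonneg _)
      (pow_le_one₀ hP.1.le (hP.2.trans hδ1))).trans (hGM j i k _)
  · intro ε hε
    -- The loss will be `P ^ (η / 2)`, which must not exceed `P ^ ε`.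
    set η := min (2 * ε) (1 / 2) with hη
    have hη0 : 0 < η := by positivity
    have hη1 : η < 1 := (min_le_right _ _).trans_lt (by norm_num)
    have hηε : η / 2 ≤ ε := by linarith [min_le_left (2 * ε) (1 / 2)]
    have herr : ∃ E > 0, ∀ (j i k : Fin K) (n : ℕ), ‖scalarQuant L (a j i k) n (G i k) - G i k‖ ≤
        E * (2 : ℝ) ^ (-(1 - η) * n / 2) := by
      choose f hf hf' using fun q : Fin K × Fin K × Fin K =>
        exists_norm_scalarQuant_sub_le hL (a q.1 q.2.1 q.2.2) (G q.2.1 q.2.2) hη0 hη1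
      obtain ⟨E, hE, h⟩ := exists_pos_forall_le f
      exact ⟨E, hE, fun j i k n => (hf' (j, i, k) n).trans (by gcongr; exact h _)⟩
    obtain ⟨E, hE, herr⟩ := herr
    set B := K * (C₀ * E * max Cy 1) with hB
    have hB0 : 0 ≤ B := by positivity
    refine ⟨B, ?_⟩
    filter_upwards [hev, hCy, eventually_ge_atTop 1] with P hP hy hP1 j
    have hP0 : 0 < P := by linarith
    have hone : (Matrix.of fun i k => (1 : ℂ) * G i k) = G := by ext; simp
    rw [hone]
    set Gj : Matrix (Fin K) (Fin K) ℂ := Matrix.of fun i k =>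
        scalarQuant L (a j i k) ⌈scalarBits P (μ P) (μ' P) i k j⌉₊ (G i k) with hGj
    obtain ⟨-, hinv⟩ := hdecay _ hP.1 hP.2 Gj (fun i k => hGM j i k _) fun i => hGc j i _
    have hμ1 : μ P ≤ 1 := hP.2.trans hδ1
    have hentry : ∀ m k, √P * ‖(channel (μ P) Gj - channel (μ P) G) m k‖ * μ P ^ gap k j ≤
        μ P ^ gap m k * (E * (max Cy 1 * P ^ (η / 2))) := by
      intro m k
      have hpos : 0 < P / μ' P ^ 2 * (μ' P ^ (2 * gap m j) / μ P ^ (2 * gap m j)) *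
          μ P ^ (2 * gap k j) := by
        have := hμ' P
        have := hP.1
        positivity
      have h1 := sqrt_mul_two_rpow_le hP0 hP.1 hμ1 (hμ' P) (hy _ (gap_lt m j)) hη0 hη1
        (le_two_pow_ceil_max_logb hpos)
      have h2 : ‖(channel (μ P) Gj - channel (μ P) G) m k‖ = μ P ^ gap m k * ‖Gj m k - G m k‖ := by
        simp only [Matrix.sub_apply, channel, Matrix.of_apply, ← mul_sub, norm_mul, norm_pow,
          Complex.norm_real, Real.norm_eq_abs, abs_of_pos hP.1]
      rw [h2]
      calc √P * (μ P ^ gap m k * ‖Gj m k - G m k‖) * μ P ^ gap k j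
          ≤ √P * (μ P ^ gap m k * (E * (2 : ℝ) ^
            (-(1 - η) * ⌈scalarBits P (μ P) (μ' P) m k j⌉₊ / 2))) * μ P ^ gap k j := by
            have := hP.1.le
            gcongr
            exact herr j m k _
        _ = μ P ^ gap m k * (E * (√P * (2 : ℝ) ^
            (-(1 - η) * ⌈scalarBits P (μ P) (μ' P) m k j⌉₊ / 2) * μ P ^ gap k j)) := by ring
        _ ≤ _ := mul_le_mul_of_nonneg_left (mul_le_mul_of_nonneg_left h1 hE.le)
            (pow_nonneg hP.1.le _)
    -- The decay `μ ^ gap r m` of the inverse and `μ ^ gap m k` of the entry error combine to `μ ^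
    -- gap r k`.
    have hmain : ∀ r k, √P * ‖((channel (μ P) Gj)⁻¹ * (channel (μ P) Gj - channel (μ P) G)) r k‖ *
        μ P ^ gap k j ≤ B * P ^ (η / 2) * μ P ^ gap r k := by
      intro r k
      calc _ ≤ √P * (∑ m, ‖(channel (μ P) Gj)⁻¹ r m‖ *
              ‖(channel (μ P) Gj - channel (μ P) G) m k‖) * μ P ^ gap k j := by
            have := hP.1.le
            gcongr
            rw [Matrix.mul_apply]
            exact (norm_sum_le _ _).trans (Finset.sum_le_sum fun m _ => (norm_mul _ _).le)
        _ = ∑ m, ‖(channel (μ P) Gj)⁻¹ r m‖ *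
              (√P * ‖(channel (μ P) Gj - channel (μ P) G) m k‖ * μ P ^ gap k j) := by
            rw [Finset.mul_sum, Finset.sum_mul]
            exact Finset.sum_congr rfl fun m _ => by ring
        _ ≤ ∑ _m : Fin K, C₀ * (E * (max Cy 1 * P ^ (η / 2))) * μ P ^ gap r k := by
            refine Finset.sum_le_sum fun m _ => ?_
            calc _ ≤ (C₀ * μ P ^ gap r m) *
                    (μ P ^ gap m k * (E * (max Cy 1 * P ^ (η / 2)))) :=
                  mul_le_mul (hinv r m) (hentry m k)
                    (mul_nonneg (by positivity) (pow_nonneg hP.1.le _))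
                    (mul_nonneg hC₀.le (pow_nonneg hP.1.le _))
              _ = C₀ * (E * (max Cy 1 * P ^ (η / 2))) * μ P ^ (gap r m + gap m k) := by
                  rw [pow_add]; ring
              _ ≤ _ := by
                  gcongr ?_ * ?_
                  exact pow_le_pow_of_le_one hP.1.le hμ1 (gap_triangle r m k)
        _ = _ := by simp [hB]; ring
    have hPε : B * P ^ (η / 2) ≤ B * P ^ ε := by gcongr
    -- In row `r = j` the factors `μ ^ gap k j` on both sides cancel; in the other rows `μ ^ gap r k
    -- ≤ 1` is enough.
    constructor
    · intro k
      have h := hmain j k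
      rw [gap_comm k j] at h
      exact (le_of_mul_le_mul_right h (pow_pos hP.1 _)).trans hPε
    · intro r k
      exact (hmain r k).trans ((mul_le_of_le_one_right (by positivity)
        (pow_le_one₀ hP.1.le hμ1)).trans hPε)

theorem measurable_uniformQuant (L : ℝ) (b : ℕ) : Measurable (uniformQuant L b) := by
  have h1 : Measurable fun x : ℝ => ⌊(x + L) / (2 * L / 2 ^ b)⌋ :=
    Int.measurable_floor.comp (by fun_prop)
  have h2 : Measurable fun n : ℤ =>
      -L + (((max 0 (min n (2 ^ b - 1)) : ℤ) : ℝ) + 1 / 2) * (2 * L / 2 ^ b) :=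
    measurable_of_countable _
  exact h2.comp h1

theorem measurable_scalarQuant (L : ℕ → ℝ) (a : ℂ) (n : ℕ) : Measurable (scalarQuant L a n) := by
  unfold scalarQuant
  split_ifs
  · exact measurable_const
  · exact measurable_complex_mk.comp
      (((measurable_uniformQuant _ _).comp Complex.measurable_re).prodMk
        ((measurable_uniformQuant _ _).comp Complex.measurable_im))

/-- Uniform scalar quantization achieves the maximal multiplexing gain. -/
theorem achievesMaximalMG_scalarPrecoder {Ω : Type*} [MeasurableSpace Ω] {ν : Measure Ω}
    [IsProbabilityMeasure ν] {K : ℕ} {G : Ω → Matrix (Fin K) (Fin K) ℂ} (hG : IsRayleigh ν G)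
    {μ μ' : ℝ → ℝ} (hμ : ∀ᶠ P in atTop, 0 < μ P) (hμ0 : Tendsto μ atTop (𝓝 0))
    (hμ' : ∀ P, 0 < μ' P) {Cy : ℝ}
    (hCy : ∀ᶠ P in atTop, ∀ d < K, μ' P * (μ P / μ' P) ^ d ≤ Cy) {L : ℕ → ℝ}
    (hL : IsAdmissibleRange L) {a : Fin K → Matrix (Fin K) (Fin K) ℂ} (ha : ∀ j i, a j i i ≠ 0) :
    AchievesMaximalMG ν (fun P ω => channel (μ P) (G ω)) (scalarPrecoder G L a μ μ') := by
  refine achievesMaximalMG_of_lower hG hμ hμ0 (fun P k l => ?_)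
    (fun P ω k l => norm_zfBeam_le P _ l k) fun p hp => ⟨id, tendsto_id, ?_⟩
  · refine measurable_effectivePrecoder P (fun j => measurable_channel _ fun i k => ?_) k l
    exact (measurable_scalarQuant _ _ _).comp (hG.1 i k)
  · filter_upwards [hG.ae_ne_zero] with ω hω i ε hε
    exact hp.eventually (eventually_le_instRate_scalarPrecoder (fun i => hω i i) hμ hμ0 hμ' hCy hL
      ha i hε)

/-! ### Small balls under the Gaussian law -/

theorem exists_le_gaussianReal_Icc :
    ∃ c > 0, ∀ a r : ℝ, |a| ≤ 2 → r ≤ 1 →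
      ENNReal.ofReal (c * r) ≤ gaussianReal 0 (1 / 2) (Set.Icc (a - r) (a + r)) := by
  -- The intervals lie in `[-3, 3]`, where the density with variance `1 / 2` is at least its peak
  -- value times `exp (-9)`.
  set c₀ : ℝ := (√(2 * Real.pi * ((1 / 2 : NNReal) : ℝ)))⁻¹ * Real.exp (-9) with hc₀
  have hc₀0 : 0 < c₀ := by
    rw [hc₀]
    have := Real.pi_pos
    have : (0 : ℝ) < ((1 / 2 : NNReal) : ℝ) := by norm_num
    positivity
  refine ⟨2 * c₀, by positivity, fun a r ha hr => ?_⟩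
  rw [gaussianReal_apply _ (by norm_num)]
  obtain ⟨ha1, ha2⟩ := abs_le.1 ha
  calc ENNReal.ofReal (2 * c₀ * r) = ENNReal.ofReal c₀ * volume (Set.Icc (a - r) (a + r)) := by
        rw [Real.volume_Icc, ← ENNReal.ofReal_mul hc₀0.le]; congr 1; ring
    _ = ∫⁻ _ in Set.Icc (a - r) (a + r), ENNReal.ofReal c₀ := by
        rw [setLIntegral_const]
    _ ≤ _ := by
        refine setLIntegral_mono' measurableSet_Icc fun x hx => ?_
        refine ENNReal.ofReal_le_ofReal ?_
        rw [gaussianPDFReal, hc₀]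
        gcongr
        obtain ⟨h1, h2⟩ := hx
        have h3 : (x - 0) ^ 2 ≤ 9 := by nlinarith
        have h4 : 2 * ((1 / 2 : NNReal) : ℝ) = 1 := by norm_num
        rw [h4]
        linarith

/-- The ball contains a square of half side `r / 2`, whose measure is a product. -/
theorem exists_le_stdComplexGaussian_closedBall :
    ∃ c > 0, ∀ (z : ℂ) (r : ℝ), ‖z‖ ≤ 2 → 0 ≤ r → r ≤ 1 →
      ENNReal.ofReal (c * r ^ 2) ≤ stdComplexGaussian (Metric.closedBall z r) := by
  obtain ⟨c, hc, h⟩ := exists_le_gaussianReal_Icc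
  refine ⟨c ^ 2 / 4, by positivity, fun z r hz hr hr1 => ?_⟩
  rw [stdComplexGaussian, Measure.map_apply measurable_complex_mk measurableSet_closedBall]
  calc ENNReal.ofReal (c ^ 2 / 4 * r ^ 2)
      = ENNReal.ofReal (c * (r / 2)) * ENNReal.ofReal (c * (r / 2)) := by
        rw [← ENNReal.ofReal_mul (by positivity)]; congr 1; ring
    _ ≤ gaussianReal 0 (1 / 2) (Set.Icc (z.re - r / 2) (z.re + r / 2)) *
        gaussianReal 0 (1 / 2) (Set.Icc (z.im - r / 2) (z.im + r / 2)) := by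
        gcongr
        · exact h _ _ ((Complex.abs_re_le_norm z).trans hz) (by linarith)
        · exact h _ _ ((Complex.abs_im_le_norm z).trans hz) (by linarith)
    _ = ((gaussianReal 0 (1 / 2)).prod (gaussianReal 0 (1 / 2)))
        (Set.Icc (z.re - r / 2) (z.re + r / 2) ×ˢ Set.Icc (z.im - r / 2) (z.im + r / 2)) :=
        (Measure.prod_prod _ _).symm
    _ ≤ _ := by
        refine measure_mono ?_
        rintro ⟨x, y⟩ ⟨⟨h1, h2⟩, h3, h4⟩
        rw [Set.mem_preimage, mem_closedBall_iff_norm]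
        refine (Complex.norm_le_abs_re_add_abs_im _).trans ?_
        simp only [Complex.sub_re, Complex.sub_im] at h1 h2 h3 h4 ⊢
        have e1 : |x - z.re| ≤ r / 2 := abs_le.2 ⟨by linarith, by linarith⟩
        have e2 : |y - z.im| ≤ r / 2 := abs_le.2 ⟨by linarith, by linarith⟩
        linarith

/-- The Gaussian probability of a neighbourhood of a complex line. -/
theorem exists_le_pi_tube (n : ℕ) :
    ∃ c > 0, ∀ (i : Fin (n + 1)) (u : Fin (n + 1) → ℂ) (r : ℝ), u i = 1 → (∀ k, ‖u k‖ ≤ 1) →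
      0 ≤ r → r ≤ 1 → ENNReal.ofReal (c * r ^ (2 * n)) ≤
        (Measure.pi fun _ : Fin (n + 1) => stdComplexGaussian)
          {g | 1 ≤ ‖g i‖ ∧ ∀ k, ‖g k - g i * u k‖ ≤ r} := by
  obtain ⟨c, hc, h⟩ := exists_le_stdComplexGaussian_closedBall
  refine ⟨c * (1 / 2) ^ 2 * c ^ n, by positivity, fun i u r hui hu hr hr1 => ?_⟩
  -- On this ball `1 ≤ ‖z‖ ≤ 2`. Given `g i = z` in it, each of the other `n` coordinates must fall
  -- into a disc of radius `r` around `z * u k`, a point of modulus at most `2`. This gives the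
  -- power `2 * n`, the real codimension of a complex line.
  set B : Set ℂ := Metric.closedBall (3 / 2 : ℂ) (1 / 2) with hB
  have hB1 : ∀ z ∈ B, 1 ≤ ‖z‖ ∧ ‖z‖ ≤ 2 := by
    intro z hz
    rw [hB, mem_closedBall_iff_norm] at hz
    have h32 : ‖(3 / 2 : ℂ)‖ = 3 / 2 := by norm_num
    have h1 := norm_le_norm_sub_add z (3 / 2)
    have h2 := norm_le_norm_sub_add (3 / 2) z
    rw [norm_sub_rev] at h2
    constructor <;> linarith
  have hγB : ENNReal.ofReal (c * (1 / 2) ^ 2) ≤ stdComplexGaussian B :=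
    h _ _ (by norm_num) (by norm_num) (by norm_num)
  set T : Set (ℂ × (Fin n → ℂ)) :=
    {q | q.1 ∈ B ∧ ∀ k, ‖q.2 k - q.1 * u (i.succAbove k)‖ ≤ r} with hT
  have hTmeas : MeasurableSet T := by
    have : T = (Prod.fst ⁻¹' B) ∩ ⋂ k, {q : ℂ × (Fin n → ℂ) |
        ‖q.2 k - q.1 * u (i.succAbove k)‖ ≤ r} := by
      ext; simp [hT]
    rw [this]
    exact (measurable_fst measurableSet_closedBall).inter
      (MeasurableSet.iInter fun k => measurableSet_le (by fun_prop) measurable_const)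
  have hmp := measurePreserving_piFinSuccAbove (fun _ : Fin (n + 1) => stdComplexGaussian) i
  calc ENNReal.ofReal (c * (1 / 2) ^ 2 * c ^ n * r ^ (2 * n))
      = ENNReal.ofReal (c * r ^ 2) ^ n * ENNReal.ofReal (c * (1 / 2) ^ 2) := by
        rw [← ENNReal.ofReal_pow (by positivity), ← ENNReal.ofReal_mul (by positivity)]
        congr 1
        rw [mul_pow, ← pow_mul]; ring
    _ ≤ ENNReal.ofReal (c * r ^ 2) ^ n * stdComplexGaussian B := by gcongr
    _ = ∫⁻ _ in B, ENNReal.ofReal (c * r ^ 2) ^ n ∂stdComplexGaussian := by rw [setLIntegral_const]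
    _ ≤ ∫⁻ z in B, (Measure.pi fun _ : Fin n => stdComplexGaussian) (Prod.mk z ⁻¹' T)
          ∂stdComplexGaussian := by
        refine setLIntegral_mono' measurableSet_closedBall fun z hz => ?_
        have hslice : Prod.mk z ⁻¹' T =
            Set.univ.pi fun k => Metric.closedBall (z * u (i.succAbove k)) r := by
          ext g
          simp [hT, hz, dist_eq_norm]
        rw [hslice, Measure.pi_pi]
        calc ENNReal.ofReal (c * r ^ 2) ^ n = ∏ _k : Fin n, ENNReal.ofReal (c * r ^ 2) := by simp
          _ ≤ _ := by
              refine Finset.prod_le_prod' fun k _ => h _ _ ?_ hr hr1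
              rw [norm_mul]
              nlinarith [(hB1 z hz).2, hu (i.succAbove k), norm_nonneg z,
                norm_nonneg (u (i.succAbove k))]
    _ ≤ ∫⁻ z, (Measure.pi fun _ : Fin n => stdComplexGaussian) (Prod.mk z ⁻¹' T)
          ∂stdComplexGaussian := setLIntegral_le_lintegral _ _
    _ = (stdComplexGaussian.prod (Measure.pi fun _ : Fin n => stdComplexGaussian)) T :=
        (Measure.prod_apply hTmeas).symm
    _ = (Measure.pi fun _ : Fin (n + 1) => stdComplexGaussian)
          (MeasurableEquiv.piFinSuccAbove (fun _ => ℂ) i ⁻¹' T) :=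
        (hmp.measure_preimage hTmeas.nullMeasurableSet).symm
    _ ≤ _ := by
        refine measure_mono fun g hg => ?_
        obtain ⟨h1, h2⟩ := hg
        refine ⟨(hB1 _ h1).1, fun k => ?_⟩
        rcases Fin.eq_self_or_eq_succAbove i k with rfl | ⟨m, rfl⟩
        · simp [hui, hr]
        · exact h2 m

/-! ### Directions close to a given line -/

/-- The Gram determinant of `w` and `h` does not change when a multiple of `h` is subtracted from
`w`. It converts between correlation with `h` and distance to the line of `h`. -/
theorem gram_sub_smul {E : Type*} [NormedAddCommGroup E] [InnerProductSpace ℂ E] (w h : E) (z : ℂ) :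
    ‖w‖ ^ 2 * ‖h‖ ^ 2 - ‖inner ℂ w h‖ ^ 2 =
      ‖w - z • h‖ ^ 2 * ‖h‖ ^ 2 - ‖inner ℂ (w - z • h) h‖ ^ 2 := by
  have h1 : inner ℂ (w - z • h) h = inner ℂ w h - star z * ((‖h‖ ^ 2 : ℝ) : ℂ) := by
    rw [inner_sub_left, inner_smul_left, inner_self_eq_norm_sq_to_K]
    simp
  have h2 : ‖w - z • h‖ ^ 2 = ‖w‖ ^ 2 - 2 * (z * inner ℂ w h).re + ‖z‖ ^ 2 * ‖h‖ ^ 2 := by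
    rw [norm_sub_sq (𝕜 := ℂ), inner_smul_right, norm_smul, mul_pow]
    simp
  rw [h1, h2, ← Complex.normSq_eq_norm_sq, ← Complex.normSq_eq_norm_sq, ← Complex.normSq_eq_norm_sq]
  simp only [Complex.normSq_apply, Complex.mul_re, Complex.sub_re, Complex.sub_im, Complex.mul_im,
    Complex.star_def, Complex.conj_re, Complex.conj_im, Complex.ofReal_re, Complex.ofReal_im]
  ring

theorem norm_inner_toLp {K : ℕ} (w h : Fin K → ℂ) :
    ‖inner ℂ (WithLp.toLp 2 w : EuclideanSpace ℂ (Fin K)) (WithLp.toLp 2 h)‖ =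
      ‖star w ⬝ᵥ h‖ := by
  rw [EuclideanSpace.inner_eq_star_dotProduct, dotProduct_comm]

theorem l2norm_sq_sub_le {K : ℕ} (w h : Fin K → ℂ) (z : ℂ) :
    l2norm w ^ 2 * l2norm h ^ 2 - ‖star w ⬝ᵥ h‖ ^ 2 ≤
      l2norm (fun k => w k - z * h k) ^ 2 * l2norm h ^ 2 := by
  have h1 := gram_sub_smul (WithLp.toLp 2 w : EuclideanSpace ℂ (Fin K)) (WithLp.toLp 2 h) z
  rw [norm_inner_toLp, ← WithLp.toLp_smul, ← WithLp.toLp_sub] at h1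
  have h2 : l2norm (fun k => w k - z * h k) =
      ‖(WithLp.toLp 2 (w - z • h) : EuclideanSpace ℂ (Fin K))‖ := rfl
  rw [h2]
  unfold l2norm
  rw [h1]
  linarith [sq_nonneg ‖inner ℂ (WithLp.toLp 2 (w - z • h) : EuclideanSpace ℂ (Fin K))
    (WithLp.toLp 2 h)‖]

theorem exists_l2norm_sub_sq_eq {K : ℕ} (w h : Fin K → ℂ) (hh : l2norm h ≠ 0) :
    ∃ z : ℂ, l2norm (fun k => w k - z * h k) ^ 2 * l2norm h ^ 2 =
      l2norm w ^ 2 * l2norm h ^ 2 - ‖star w ⬝ᵥ h‖ ^ 2 := by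
  set x : EuclideanSpace ℂ (Fin K) := WithLp.toLp 2 w with hx
  set y : EuclideanSpace ℂ (Fin K) := WithLp.toLp 2 h with hy
  have hy0 : (‖y‖ : ℂ) ≠ 0 := by exact_mod_cast hh
  refine ⟨inner ℂ y x / (‖y‖ : ℂ) ^ 2, ?_⟩
  have h1 := gram_sub_smul x y (inner ℂ y x / (‖y‖ : ℂ) ^ 2)
  have h0 : inner ℂ (x - (inner ℂ y x / (‖y‖ : ℂ) ^ 2) • y) y = 0 := by
    rw [inner_sub_left, inner_smul_left, inner_self_eq_norm_sq_to_K]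
    simp only [map_div₀, inner_conj_symm, map_pow, Complex.conj_ofReal]
    exact sub_eq_zero.2 (div_mul_cancel₀ _ (pow_ne_zero 2 hy0)).symm
  rw [h0, norm_zero, norm_inner_toLp] at h1
  have h2 : l2norm (fun k => w k - inner ℂ y x / (‖y‖ : ℂ) ^ 2 * h k) =
      ‖x - (inner ℂ y x / (‖y‖ : ℂ) ^ 2) • y‖ := rfl
  rw [h2]
  change _ = ‖x‖ ^ 2 * ‖y‖ ^ 2 - _
  rw [h1]
  change _ * ‖y‖ ^ 2 = _
  ring

/-- Write `b = z * h + e` with `‖e‖ ≤ κ`. As `h i` is the largest entry of `h`, `‖z * h i‖ ≥ 1 / (2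
* K)` and hence `‖b i‖ ≥ 1 / (4 * K)`. Dividing by `‖b i‖` costs `4 * K`, and there are two error
terms: one from entry `k` and one from the reference entry `i`. -/
theorem norm_fixPhase_sub_le {K : ℕ} {b h : Fin K → ℂ} {i : Fin K} (hb : l2norm b = 1)
    (hi : h i ≠ 0) (hle : ∀ k, ‖h k‖ ≤ ‖h i‖) {κ : ℝ} (hκ0 : 0 ≤ κ) (hκ : κ ≤ 1 / (4 * K))
    (hκ1 : κ ≤ 1 / 2)
    (hcap : (1 - κ ^ 2) * l2norm h ^ 2 ≤ ‖star b ⬝ᵥ h‖ ^ 2) :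
    0 < ‖b i‖ ∧ ∀ k, ‖((‖b i‖⁻¹ : ℝ) : ℂ) * fixPhase i b k - (h i)⁻¹ * h k‖ ≤ 8 * K * κ := by
  have hK : (0 : ℝ) < K := by exact_mod_cast i.pos
  have hni := norm_pos_iff.2 hi
  have hh0 : 0 < l2norm h := hni.trans_le (norm_le_l2norm h i)
  obtain ⟨z, hz⟩ := exists_l2norm_sub_sq_eq b h hh0.ne'
  set e : Fin K → ℂ := fun k => b k - z * h k with he
  have heκ : l2norm e ≤ κ := by
    refine le_of_sq_le_sq ?_ hκ0
    rw [hb] at hz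
    refine le_of_mul_le_mul_right ?_ (pow_pos hh0 2)
    linarith
  have hek : ∀ k, ‖e k‖ ≤ κ := fun k => (norm_le_l2norm e k).trans heκ
  have hbz : ∀ k, b k = z * h k + e k := fun k => by rw [he]; ring
  have hhK : l2norm h ≤ K * ‖h i‖ := by
    refine (l2norm_le_sum h).trans ?_
    calc ∑ k, ‖h k‖ ≤ ∑ _k : Fin K, ‖h i‖ := Finset.sum_le_sum fun k _ => hle k
      _ = _ := by simp
  have hzh : 1 / 2 ≤ ‖z‖ * l2norm h := by
    have h1 := abs_l2norm_sub_le b (fun k => z * h k)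
    rw [l2norm_smul, hb] at h1
    have := (le_abs_self _).trans (h1.trans heκ)
    linarith
  have hzi : 1 / (2 * K) ≤ ‖z * h i‖ := by
    rw [norm_mul, div_le_iff₀ (by positivity)]
    have : ‖z‖ * l2norm h ≤ ‖z‖ * (K * ‖h i‖) := by gcongr
    nlinarith
  have hρ : 1 / (4 * K) ≤ ‖b i‖ := by
    have h1 : ‖z * h i‖ ≤ ‖b i‖ + ‖e i‖ := by
      have : z * h i = b i - e i := by rw [hbz i]; ring
      rw [this]; exact norm_sub_le _ _
    have h2 : 1 / (2 * (K : ℝ)) = 1 / (4 * K) + 1 / (4 * K) := by field_simp; norm_num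
    linarith [hek i]
  have hρ0 : 0 < ‖b i‖ := lt_of_lt_of_le (by positivity) hρ
  refine ⟨hρ0, fun k => ?_⟩
  set φ : ℂ := star (b i) / (‖b i‖ : ℂ) with hφ
  have hφ1 : ‖φ‖ = 1 := by
    rw [hφ, norm_div, norm_star, Complex.norm_real, norm_norm, div_self hρ0.ne']
  have hρc : (‖b i‖ : ℂ) ≠ 0 := by exact_mod_cast hρ0.ne'
  have hφb : φ * b i = (‖b i‖ : ℂ) := by
    rw [hφ, div_mul_eq_mul_div, div_eq_iff hρc, Complex.star_def, Complex.conj_mul', sq]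
  have hu : ‖(h i)⁻¹ * h k‖ ≤ 1 := by
    rw [norm_mul, norm_inv, inv_mul_le_iff₀ hni, mul_one]; exact hle k
  have hid : ((‖b i‖⁻¹ : ℝ) : ℂ) * fixPhase i b k - (h i)⁻¹ * h k =
      ((‖b i‖⁻¹ : ℝ) : ℂ) * (φ * e k - φ * e i * ((h i)⁻¹ * h k)) := by
    have h1 : fixPhase i b k = φ * b k := rfl
    have h2 : φ * e i = (‖b i‖ : ℂ) - φ * z * h i := by rw [← hφb, hbz i]; ring
    rw [h1, h2, hbz k]
    push_cast
    field_simp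
    ring
  rw [hid, norm_mul, Complex.norm_real, Real.norm_eq_abs, abs_of_pos (inv_pos.2 hρ0)]
  have hinv : ‖b i‖⁻¹ ≤ 4 * K := by
    rw [inv_le_comm₀ hρ0 (by positivity)]
    simpa using hρ
  calc _ ≤ 4 * K * (κ + κ * 1) := by
        refine mul_le_mul hinv ((norm_sub_le _ _).trans (add_le_add ?_ ?_)) (norm_nonneg _)
          (by positivity)
        · rw [norm_mul, hφ1, one_mul]; exact hek k
        · rw [norm_mul, norm_mul, hφ1, one_mul]
          exact mul_le_mul (hek i) hu (norm_nonneg _) hκ0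
    _ = _ := by ring

/-! ### Random codebooks -/

theorem measurable_div_l2norm (K : ℕ) :
    Measurable fun (g : Fin K → ℂ) (k : Fin K) => g k / (l2norm g : ℂ) :=
  measurable_pi_lambda _ fun k =>
    (measurable_pi_apply k).div (Complex.measurable_ofReal.comp measurable_l2norm)

instance (K : ℕ) : IsProbabilityMeasure (isotropicLaw K) :=
  Measure.isProbabilityMeasure_map (measurable_div_l2norm K).aemeasurable

theorem measurable_norm_star_dotProduct {α : Type*} [MeasurableSpace α] {K : ℕ}
    {w h : α → Fin K → ℂ} (hw : Measurable w) (hh : Measurable h) :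
    Measurable fun x => ‖star (w x) ⬝ᵥ h x‖ := by
  simp only [dotProduct, Pi.star_apply]
  refine Measurable.norm (Finset.measurable_sum _ fun k _ => ?_)
  exact (continuous_star.measurable.comp ((measurable_pi_apply k).comp hw)).mul ((measurable_pi_apply k).comp hh)

theorem ae_isotropicLaw_l2norm_eq_one {K : ℕ} (i : Fin K) :
    ∀ᵐ w ∂isotropicLaw K, l2norm w = 1 := by
  rw [isotropicLaw, ae_map_iff (measurable_div_l2norm K).aemeasurable
    (measurableSet_eq_fun measurable_l2norm measurable_const)]
  have h : ∀ᵐ g ∂(Measure.pi fun _ : Fin K => stdComplexGaussian), g i ≠ 0 := by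
    refine (measurePreserving_eval (fun _ : Fin K => stdComplexGaussian) i).quasiMeasurePreserving.ae
      (p := fun z => z ≠ 0) ?_
    rw [ae_iff]
    simpa using stdComplexGaussian_singleton 0
  filter_upwards [h] with g hg
  have h0 : 0 < l2norm g := (norm_pos_iff.2 hg).trans_le (norm_le_l2norm g i)
  have : (fun k => g k / (l2norm g : ℂ)) = fun k => ((l2norm g : ℂ)⁻¹) * g k := by
    funext k; rw [div_eq_inv_mul]
  rw [this, l2norm_smul, norm_inv, Complex.norm_real, Real.norm_eq_abs, abs_of_pos h0,
    inv_mul_cancel₀ h0.ne']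

/-- The probability that an isotropic unit vector is close to a given line. -/
theorem exists_le_isotropicLaw_cap (n : ℕ) :
    ∃ c > 0, ∀ (i : Fin (n + 1)) (h : Fin (n + 1) → ℂ) (r : ℝ), h i ≠ 0 →
      (∀ k, ‖h k‖ ≤ ‖h i‖) → 0 ≤ r → r ≤ 1 → ENNReal.ofReal (c * r ^ (2 * n)) ≤
        isotropicLaw (n + 1)
          {w | (1 - ((n + 1 : ℕ) * r) ^ 2) * l2norm h ^ 2 ≤ ‖star w ⬝ᵥ h‖ ^ 2} := by
  obtain ⟨c, hc, H⟩ := exists_le_pi_tube n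
  refine ⟨c, hc, fun i h r hi hle hr hr1 => ?_⟩
  have hni := norm_pos_iff.2 hi
  have hu : ∀ k, ‖(h i)⁻¹ * h k‖ ≤ 1 := fun k => by
    rw [norm_mul, norm_inv, inv_mul_le_iff₀ hni, mul_one]; exact hle k
  refine (H i (fun k => (h i)⁻¹ * h k) r (inv_mul_cancel₀ hi) hu hr hr1).trans ?_
  have hmeas : Measurable fun w : Fin (n + 1) → ℂ => ‖star w ⬝ᵥ h‖ :=
    measurable_norm_star_dotProduct measurable_id measurable_const
  rw [isotropicLaw, Measure.map_apply (measurable_div_l2norm _)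
    (measurableSet_le measurable_const (hmeas.pow_const 2))]
  refine measure_mono fun g hg => ?_
  obtain ⟨h1, h2⟩ := hg
  have hg1 : 1 ≤ l2norm g := h1.trans (norm_le_l2norm g i)
  have hg0 : 0 < l2norm g := by linarith
  rw [Set.mem_preimage, Set.mem_ofPred_eq]
  set w : Fin (n + 1) → ℂ := fun k => g k / (l2norm g : ℂ) with hw
  have hw1 : l2norm w = 1 := by
    have : w = fun k => ((l2norm g : ℂ)⁻¹) * g k := by
      funext k; simp only [hw, div_eq_inv_mul]
    rw [this, l2norm_smul, norm_inv, Complex.norm_real, Real.norm_eq_abs, abs_of_pos hg0,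
      inv_mul_cancel₀ hg0.ne']
  have h3 := l2norm_sq_sub_le w h ((l2norm g : ℂ)⁻¹ * (g i * (h i)⁻¹))
  -- Normalizing `g` does not increase its distance to the line, since `l2norm g ≥ 1`; summing over
  -- the entries gives the factor `n + 1`.
  have h4 : l2norm (fun k => w k - (l2norm g : ℂ)⁻¹ * (g i * (h i)⁻¹) * h k) ≤
      (n + 1 : ℕ) * r := by
    have : (fun k => w k - (l2norm g : ℂ)⁻¹ * (g i * (h i)⁻¹) * h k) =
        fun k => (l2norm g : ℂ)⁻¹ * (g k - g i * ((h i)⁻¹ * h k)) := by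
      funext k; rw [hw]; ring
    rw [this, l2norm_smul, norm_inv, Complex.norm_real, Real.norm_eq_abs, abs_of_pos hg0]
    calc _ ≤ 1 * l2norm (fun k => g k - g i * ((h i)⁻¹ * h k)) := by
          gcongr
          · exact l2norm_nonneg _
          · exact inv_le_one_of_one_le₀ hg1
      _ ≤ ∑ k, ‖g k - g i * ((h i)⁻¹ * h k)‖ := by rw [one_mul]; exact l2norm_le_sum _
      _ ≤ ∑ _k : Fin (n + 1), r := Finset.sum_le_sum fun k _ => h2 k
      _ = _ := by simp
  have h5 : l2norm (fun k => w k - (l2norm g : ℂ)⁻¹ * (g i * (h i)⁻¹) * h k) ^ 2 *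
      l2norm h ^ 2 ≤ ((n + 1 : ℕ) * r) ^ 2 * l2norm h ^ 2 := by
    gcongr
    exact l2norm_nonneg _
  rw [hw1] at h3
  linarith

theorem le_norm_bestCodeword {K : ℕ} (w : ℕ → Fin K → ℂ) (h : Fin K → ℂ) {m n : ℕ} (hmn : m ≤ n) :
    ‖star (w m) ⬝ᵥ h‖ ≤ ‖star (bestCodeword w h n) ⬝ᵥ h‖ := by
  induction n with
  | zero => obtain rfl : m = 0 := by omega
            exact le_rfl
  | succ n ih =>
    rw [bestCodeword]
    rcases Nat.lt_or_ge n m with h1 | h1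
    · obtain rfl : m = n + 1 := by omega
      split_ifs with h2
      · exact le_rfl
      · exact not_lt.1 h2
    · split_ifs with h2
      · exact (ih h1).trans h2.le
      · exact ih h1

theorem exists_bestCodeword_eq {K : ℕ} (w : ℕ → Fin K → ℂ) (h : Fin K → ℂ) (n : ℕ) :
    ∃ m, bestCodeword w h n = w m := by
  induction n with
  | zero => exact ⟨0, rfl⟩
  | succ n ih =>
    rw [bestCodeword]
    split_ifs
    exacts [⟨_, rfl⟩, ih]

theorem measurable_bestCodeword {Ω : Type*} [MeasurableSpace Ω] {K : ℕ} {w : ℕ → Ω → Fin K → ℂ}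
    {h : Ω → Fin K → ℂ} (hw : ∀ n, Measurable (w n)) (hh : Measurable h) (n : ℕ) :
    Measurable fun ω => bestCodeword (fun m => w m ω) (h ω) n := by
  induction n with
  | zero => exact hw 0
  | succ n ih =>
    simp only [bestCodeword]
    exact Measurable.ite (measurableSet_lt (measurable_norm_star_dotProduct ih hh)
      (measurable_norm_star_dotProduct (hw _) hh)) (hw _) ih

/-- The probability that `N` i.i.d. trials which are independent of `X` all fall into a set
that depends on `X`. -/
theorem measure_forall_mem_le {Ω α β : Type*} [MeasurableSpace Ω] [MeasurableSpace α]
    [MeasurableSpace β] {ν : Measure Ω} [IsProbabilityMeasure ν] {X : Ω → α} {W : ℕ → Ω → β}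
    (hX : Measurable X) (hW : ∀ n, Measurable (W n)) (hind : IndepFun X (fun ω n => W n ω) ν)
    (hiid : iIndepFun W ν) {law : Measure β} (hlaw : ∀ n, ν.map (W n) = law) {D : Set α}
    (hD : MeasurableSet D) {S : Set (α × β)} (hS : MeasurableSet S) {t : ENNReal}
    (ht : ∀ x ∈ D, law (Prod.mk x ⁻¹' S) ≤ t) (N : ℕ) :
    ν {ω | X ω ∈ D ∧ ∀ m < N, (X ω, W m ω) ∈ S} ≤ t ^ N := by
  have hY : Measurable fun ω n => W n ω := measurable_pi_lambda _ hW
  set A : Set (α × (ℕ → β)) := {q | q.1 ∈ D ∧ ∀ m < N, (q.1, q.2 m) ∈ S} with hA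
  have hAmeas : MeasurableSet A := by
    have : A = (Prod.fst ⁻¹' D) ∩
        ⋂ m, ⋂ (_ : m < N), (fun q : α × (ℕ → β) => (q.1, q.2 m)) ⁻¹' S := by ext; simp [hA]
    rw [this]
    refine (measurable_fst hD).inter (MeasurableSet.iInter fun m => MeasurableSet.iInter fun _ => ?_)
    exact (measurable_fst.prodMk ((measurable_pi_apply m).comp measurable_snd)) hS
  have hprob : IsProbabilityMeasure (ν.map X) := Measure.isProbabilityMeasure_map hX.aemeasurable
  have hprob' : IsProbabilityMeasure (ν.map fun ω n => W n ω) :=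
    Measure.isProbabilityMeasure_map hY.aemeasurable
  calc ν {ω | X ω ∈ D ∧ ∀ m < N, (X ω, W m ω) ∈ S}
      = (ν.map fun ω => (X ω, fun n => W n ω)) A := (Measure.map_apply (hX.prodMk hY) hAmeas).symm
    _ = ((ν.map X).prod (ν.map fun ω n => W n ω)) A := by
        rw [(indepFun_iff_map_prod_eq_prod_map_map hX.aemeasurable hY.aemeasurable).1 hind]
    _ = ∫⁻ x, (ν.map fun ω n => W n ω) (Prod.mk x ⁻¹' A) ∂(ν.map X) := Measure.prod_apply hAmeas
    _ ≤ ∫⁻ _, t ^ N ∂(ν.map X) := by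
        refine lintegral_mono fun x => ?_
        by_cases hx : x ∈ D
        · have hSx : MeasurableSet (Prod.mk x ⁻¹' S) := measurable_prodMk_left hS
          rw [Measure.map_apply hY (measurable_prodMk_left hAmeas)]
          have hset : (fun ω n => W n ω) ⁻¹' (Prod.mk x ⁻¹' A) =
              ⋂ m ∈ Finset.range N, W m ⁻¹' (Prod.mk x ⁻¹' S) := by
            ext ω; simp [hA, hx]
          rw [hset, hiid.measure_inter_preimage_eq_mul (Finset.range N) fun _ _ => hSx]
          calc ∏ m ∈ Finset.range N, ν (W m ⁻¹' (Prod.mk x ⁻¹' S))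
              ≤ ∏ _m ∈ Finset.range N, t := by
                refine Finset.prod_le_prod' fun m _ => ?_
                rw [← Measure.map_apply (hW m) hSx, hlaw m]
                exact ht x hx
            _ = t ^ N := by simp
        · have : Prod.mk x ⁻¹' A = ∅ := by ext; simp [hA, hx]
          rw [this, measure_empty]
          exact zero_le
    _ = t ^ N := by simp

/-- The cap estimate and the phase normalization both take the direct entry as the reference and
need it to be the largest of the row. -/
theorem eventually_norm_channel_le_diag {ι : Type*} {l : Filter ι} {m : ι → ℝ}
    (hm0 : ∀ᶠ n in l, 0 < m n) (hm : Tendsto m l (𝓝 0)) {K : ℕ} {G : Matrix (Fin K) (Fin K) ℂ}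
    (i : Fin K) (hG : G i i ≠ 0) :
    ∀ᶠ n in l, ∀ k, ‖channel (m n) G i k‖ ≤ ‖channel (m n) G i i‖ := by
  rw [eventually_all]
  intro k
  rcases eq_or_ne k i with rfl | hk
  · exact Eventually.of_forall fun _ => le_rfl
  have hlim : Tendsto (fun n => m n * ‖G i k‖) l (𝓝 (0 * ‖G i k‖)) := hm.mul_const _
  rw [zero_mul] at hlim
  filter_upwards [hm0, hm.eventually (ge_mem_nhds one_pos),
    hlim.eventually (ge_mem_nhds (norm_pos_iff.2 hG))] with n h0 h1 h2
  rw [norm_channel h0.le, norm_channel h0.le, gap_self, pow_zero, one_mul]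
  refine le_trans ?_ h2
  gcongr
  calc m n ^ gap i k ≤ m n ^ 1 := pow_le_pow_of_le_one h0.le h1 (gap_pos hk.symm)
    _ = m n := pow_one _

/-- With sufficiently large random codebooks, the best codeword almost surely is eventually close
to the line of the channel vector. -/
theorem ae_eventually_cap {Ω : Type*} [MeasurableSpace Ω] {ν : Measure Ω} [IsProbabilityMeasure ν]
    {K : ℕ} {G : Ω → Matrix (Fin K) (Fin K) ℂ} (hG : IsRayleigh ν G) {W : ℕ → Ω → Fin K → ℂ}
    (hW : IsRandomCodebook ν G W) (i : Fin K) {m r : ℕ → ℝ} {N : ℕ → ℕ}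
    (hm0 : ∀ᶠ n in atTop, 0 < m n) (hm : Tendsto m atTop (𝓝 0))
    (hr : ∀ᶠ n in atTop, 0 ≤ r n ∧ r n ≤ 1)
    (hN : ∀ᶠ n : ℕ in atTop, (n : ℝ) + 1 ≤ N n * r n ^ (2 * (K - 1))) :
    ∀ᵐ ω ∂ν, ∀ᶠ n in atTop,
      (1 - (K * r n) ^ 2) * l2norm (channel (m n) (G ω) i) ^ 2 ≤
        ‖star (bestCodeword (fun k => W k ω) (channel (m n) (G ω) i) (N n - 1)) ⬝ᵥ
          channel (m n) (G ω) i‖ ^ 2 := by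
  obtain ⟨s, rfl⟩ : ∃ s, K = s + 1 := ⟨K - 1, by have := i.pos; omega⟩
  rw [Nat.add_sub_cancel] at hN
  obtain ⟨hWm, hWi, hWl, hWG⟩ := hW
  obtain ⟨c, hc, hcap⟩ := exists_le_isotropicLaw_cap s
  set X : Ω → Fin (s + 1) × Fin (s + 1) → ℂ := fun ω q => G ω q.1 q.2 with hX
  have hXm : Measurable X := measurable_pi_lambda _ fun q => hG.1 q.1 q.2
  set v : ℕ → (Fin (s + 1) × Fin (s + 1) → ℂ) → Fin (s + 1) → ℂ :=
    fun n x k => (m n : ℂ) ^ gap i k * x (i, k) with hv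
  have hvm : ∀ n, Measurable (v n) := fun n => measurable_pi_lambda _ fun k =>
    (measurable_pi_apply (i, k)).const_mul _
  set D : ℕ → Set (Fin (s + 1) × Fin (s + 1) → ℂ) :=
    fun n => {x | v n x i ≠ 0 ∧ ∀ k, ‖v n x k‖ ≤ ‖v n x i‖} with hD
  have hvk : ∀ n k, Measurable fun x => v n x k := fun n k => (measurable_pi_apply k).comp (hvm n)
  have hDm : ∀ n, MeasurableSet (D n) := fun n => by
    have : D n = {x | v n x i = 0}ᶜ ∩ ⋂ k, {x | ‖v n x k‖ ≤ ‖v n x i‖} := by ext; simp [hD]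
    rw [this]
    exact (measurableSet_eq_fun (hvk n i) measurable_const).compl.inter
      (MeasurableSet.iInter fun k => measurableSet_le (hvk n k).norm (hvk n i).norm)
  set S : ℕ → Set ((Fin (s + 1) × Fin (s + 1) → ℂ) × (Fin (s + 1) → ℂ)) := fun n =>
    {q | ‖star q.2 ⬝ᵥ v n q.1‖ ^ 2 < (1 - ((s + 1 : ℕ) * r n) ^ 2) * l2norm (v n q.1) ^ 2} with hS
  have hSm : ∀ n, MeasurableSet (S n) := fun n =>
    measurableSet_lt ((measurable_norm_star_dotProduct measurable_snd
      ((hvm n).comp measurable_fst)).pow_const 2)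
      (((measurable_l2norm.comp ((hvm n).comp measurable_fst)).pow_const 2).const_mul _)
  -- The deterministic conditions are part of the event, so that it is empty where they fail and the
  -- bound on its probability holds for all `n`. Otherwise this probability is at most `(1 - c * r ^
  -- (2 * s)) ^ N ≤ exp (-c * (n + 1))`.
  set bad : ℕ → Set Ω := fun n => {ω | ((0 ≤ r n ∧ r n ≤ 1) ∧ (n : ℝ) + 1 ≤ N n * r n ^ (2 * s)) ∧
    X ω ∈ D n ∧ ∀ k < N n, (X ω, W k ω) ∈ S n} with hbad
  have hmeas : ∀ n, ν (bad n) ≤ ENNReal.ofReal (Real.exp (-c) ^ (n + 1)) := by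
    intro n
    by_cases hn : (0 ≤ r n ∧ r n ≤ 1) ∧ (n : ℝ) + 1 ≤ N n * r n ^ (2 * s)
    · obtain ⟨⟨hr0, hr1⟩, hNn⟩ := hn
      have hle := measure_forall_mem_le hXm hWm hWG hWi hWl (hDm n) (hSm n)
        (t := ENNReal.ofReal (Real.exp (-(c * r n ^ (2 * s))))) (fun x hx => ?_) (N n)
      · calc ν (bad n) ≤ _ := measure_mono fun ω hω => hω.2
          _ ≤ _ := hle
          _ ≤ _ := by
              rw [← ENNReal.ofReal_pow (Real.exp_pos _).le, ← Real.exp_nat_mul, ← Real.exp_nat_mul]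
              refine ENNReal.ofReal_le_ofReal (Real.exp_le_exp.2 ?_)
              push_cast
              nlinarith
      · have h1 := hcap i (v n x) (r n) hx.1 hx.2 hr0 hr1
        have hcompl : Prod.mk x ⁻¹' S n = {w | (1 - ((s + 1 : ℕ) * r n) ^ 2) * l2norm (v n x) ^ 2 ≤
            ‖star w ⬝ᵥ v n x‖ ^ 2}ᶜ := by
          ext w; simp [hS]
        have hm' : MeasurableSet {w : Fin (s + 1) → ℂ |
            (1 - ((s + 1 : ℕ) * r n) ^ 2) * l2norm (v n x) ^ 2 ≤ ‖star w ⬝ᵥ v n x‖ ^ 2} := by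
          have hmeas : Measurable fun w : Fin (s + 1) → ℂ => ‖star w ⬝ᵥ v n x‖ :=
            measurable_norm_star_dotProduct measurable_id measurable_const
          exact measurableSet_le measurable_const (hmeas.pow_const 2)
        rw [hcompl, prob_compl_eq_one_sub hm']
        calc 1 - _ ≤ 1 - ENNReal.ofReal (c * r n ^ (2 * s)) := tsub_le_tsub_left h1 _
          _ = ENNReal.ofReal (1 - c * r n ^ (2 * s)) := by
              rw [ENNReal.ofReal_sub _ (by positivity), ENNReal.ofReal_one]
          _ ≤ _ := ENNReal.ofReal_le_ofReal (by
              linarith [Real.add_one_le_exp (-(c * r n ^ (2 * s)))])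
    · have : bad n = ∅ := by
        ext ω
        simp only [hbad, Set.mem_ofPred_eq, Set.mem_empty_iff_false, iff_false]
        exact fun h => hn h.1
      rw [this, measure_empty]
      exact zero_le
  have hsum : ∑' n, ν (bad n) ≠ ⊤ := by
    refine ne_top_of_le_ne_top ?_ (ENNReal.tsum_le_tsum hmeas)
    refine Summable.tsum_ofReal_ne_top ?_
    exact (summable_nat_add_iff 1).2
      (summable_geometric_of_lt_one (Real.exp_pos _).le (by simpa using hc))
  filter_upwards [ae_eventually_notMem hsum, hG.ae_ne_zero] with ω hω hne
  have hdiag := eventually_norm_channel_le_diag hm0 hm i (hne i i)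
  filter_upwards [hω, hdiag, hr, hN] with n h1 h2 h3 h4
  by_contra hlt
  refine h1 ⟨⟨h3, h4⟩, ⟨?_, h2⟩, fun k hk => ?_⟩
  · simpa [hv, gap_self] using hne i i
  · have h5 := le_norm_bestCodeword (fun k => W k ω) (channel (m n) (G ω) i)
      (show k ≤ N n - 1 by omega)
    have h6 : ‖star (W k ω) ⬝ᵥ channel (m n) (G ω) i‖ ^ 2 ≤
        ‖star (bestCodeword (fun k => W k ω) (channel (m n) (G ω) i) (N n - 1)) ⬝ᵥ
          channel (m n) (G ω) i‖ ^ 2 := by gcongr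
    exact lt_of_le_of_lt h6 (not_le.1 hlt)

/-! ### Zero forcing from quantized row directions -/

theorem norm_star_dotProduct_of_card_one {K : ℕ} (hK : K = 1) (b h : Fin K → ℂ) :
    ‖star b ⬝ᵥ h‖ ^ 2 = l2norm b ^ 2 * l2norm h ^ 2 := by
  subst hK
  simp [l2norm_sq, dotProduct, mul_pow]

theorem pow_le_two_pow_ceil {x : ℝ} (hx : 0 < x) {K : ℕ} (hK : 1 ≤ K) :
    x ^ (K - 1) ≤ 2 ^ ⌈((K : ℝ) - 1) * max (Real.logb 2 x) 0⌉₊ := by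
  have hK' : (1 : ℝ) ≤ K := by exact_mod_cast hK
  have h : Real.logb 2 (x ^ (K - 1)) ≤ (⌈((K : ℝ) - 1) * max (Real.logb 2 x) 0⌉₊ : ℝ) := by
    rw [Real.logb_pow]
    refine le_trans ?_ (Nat.le_ceil _)
    rw [Nat.cast_sub hK, Nat.cast_one]
    exact mul_le_mul_of_nonneg_left (le_max_left _ _) (by linarith)
  rwa [Real.logb_le_iff_le_rpow one_lt_two (by positivity), Real.rpow_natCast] at h

theorem tendsto_succ_div_pow {b : ℝ} (hb : 1 < b) :
    Tendsto (fun n : ℕ => ((n : ℝ) + 1) / b ^ n) atTop (𝓝 0) := by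
  have h := (tendsto_pow_const_div_const_pow_of_one_lt 1 hb).add
    (tendsto_pow_const_div_const_pow_of_one_lt 0 hb)
  rw [add_zero] at h
  refine h.congr fun n => ?_
  rw [pow_one, pow_zero, add_div]

theorem tendsto_succ_div_sqrt {p : ℕ → ℝ} (hp : ∀ n : ℕ, 2 ^ n ≤ p n) (C : ℝ) :
    Tendsto (fun n : ℕ => C * (((n : ℝ) + 1) / √(p n))) atTop (𝓝 0) := by
  rw [← mul_zero C]
  refine Tendsto.const_mul _ (squeeze_zero (fun n => by positivity) (fun n => ?_)
    (tendsto_succ_div_pow (b := √2) (by rw [Real.lt_sqrt] <;> norm_num)))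
  gcongr
  refine Real.le_sqrt_of_sq_le ?_
  rw [← pow_mul, mul_comm, pow_mul, Real.sq_sqrt zero_le_two]
  exact hp n

/-- Zero forcing with row estimates that, up to positive scalings, differ from the normalized rows
of the channel by `(n + 1) / √(p n)`, where `p n` grows exponentially. -/
theorem eventually_le_instRate_of_directions {K : ℕ} {G : Matrix (Fin K) (Fin K) ℂ}
    (hG : ∀ i, G i i ≠ 0) {p m : ℕ → ℝ} (hp : ∀ n : ℕ, 2 ^ n ≤ p n)
    (hm0 : ∀ᶠ n in atTop, 0 < m n) (hm : Tendsto m atTop (𝓝 0))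
    {R : ℕ → Fin K → Matrix (Fin K) (Fin K) ℂ} {ρ : ℕ → Fin K → Fin K → ℝ} {C : ℝ}
    (hρ : ∀ᶠ n in atTop, ∀ j i, 0 < ρ n j i)
    (hR : ∀ᶠ n : ℕ in atTop, ∀ j i k, ‖(ρ n j i : ℂ) * R n j i k -
      channel (m n) (Matrix.of fun i k => (G i i)⁻¹ * G i k) i k‖ ≤ C * ((n + 1) / √(p n)))
    (i : Fin K) {ε : ℝ} (hε : 0 < ε) :
    ∀ᶠ n in atTop, (1 - ε) * Real.logb 2 (p n) ≤
      instRate (channel (m n) G) (effectivePrecoder (p n) (R n)) i := by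
  have hK : (0 : ℝ) < K := by exact_mod_cast i.pos
  have hp0 : ∀ n, 0 < p n := fun n => lt_of_lt_of_le (by positivity) (hp n)
  have hpt : Tendsto p atTop atTop :=
    tendsto_atTop_mono hp (tendsto_pow_atTop_atTop_of_one_lt one_lt_two)
  set G' : Matrix (Fin K) (Fin K) ℂ := Matrix.of fun i k => (G i i)⁻¹ * G i k with hG'
  have hG'1 : ∀ i, G' i i = 1 := fun i => by simp [hG', hG i]
  obtain ⟨M, hM, -, -, hGM, -⟩ := exists_bounds_of_diag_ne_zero G' fun i => by simp [hG'1]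
  have herr := tendsto_succ_div_sqrt hp C
  set A : ℕ → Fin K → Matrix (Fin K) (Fin K) ℂ := fun n j =>
    Matrix.diagonal (fun i => (ρ n j i : ℂ)) * R n j with hA
  have hAR : ∀ n j i k, A n j i k = (ρ n j i : ℂ) * R n j i k := fun n j i k => by
    simp [hA, Matrix.diagonal_mul]
  -- With an estimation error of at most `1 / (8 * K)` as well, the off-diagonal entries are at most
  -- `1 / (4 * K)`, the dominance condition for `c = 1 / 2`. Constant weights then bound the inverse
  -- by `2 / c = 4`; no decay is needed, as the row errors are uniformly small.
  have hoff : ∀ᶠ n in atTop, M * m n ≤ 1 / (8 * K) := by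
    have : Tendsto (fun n => M * m n) atTop (𝓝 (M * 0)) := hm.const_mul M
    rw [mul_zero] at this
    exact this.eventually (ge_mem_nhds (by positivity))
  have hKone : 1 / (8 * (K : ℝ)) ≤ 1 / 2 := by
    have : (1 : ℝ) ≤ K := by exact_mod_cast i.pos
    rw [div_le_div_iff₀ (by positivity) two_pos]; linarith
  have hgood : ∀ᶠ n in atTop, ∀ j, IsUnit (A n j).det ∧ (∀ i k, ‖A n j i k‖ ≤ M + 1) ∧
      ∀ r k, ‖(A n j)⁻¹ r k‖ ≤ 4 := by
    filter_upwards [hR, hm0, hm.eventually (ge_mem_nhds one_pos), hoff,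
      herr.eventually (ge_mem_nhds (show (0 : ℝ) < 1 / (8 * K) by positivity))] with
      n hRn h0 h1 hoffn hsmall j
    have hd : ∀ i k, ‖A n j i k - channel (m n) G' i k‖ ≤ 1 / (8 * K) := fun i k => by
      rw [hAR]; exact (hRn j i k).trans hsmall
    have hdiag : ∀ i, (1 / 2 : ℝ) ≤ ‖A n j i i‖ := fun i => by
      have h2 : channel (m n) G' i i = 1 := by simp [channel, gap_self, hG'1]
      have h3 := norm_le_norm_sub_add (1 : ℂ) (A n j i i)
      rw [norm_sub_rev, ← h2, norm_one.symm.trans (congrArg norm h2.symm) |>.symm] at h3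
      linarith [hd i i]
    have hoffd : ∀ i k, k ≠ i → ‖A n j i k‖ ≤ 1 / 2 / (2 * K) := fun i k hk => by
      have h2 : ‖channel (m n) G' i k‖ ≤ M * m n := by
        rw [norm_channel h0.le, mul_comm]
        gcongr
        · exact hGM i k
        · calc m n ^ gap i k ≤ m n ^ 1 := pow_le_pow_of_le_one h0.le h1 (gap_pos hk.symm)
            _ = m n := pow_one _
      have h3 := norm_le_norm_sub_add (A n j i k) (channel (m n) G' i k)
      have h4 : 1 / 2 / (2 * (K : ℝ)) = 1 / (8 * K) + 1 / (8 * K) := by field_simp; norm_num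
      linarith [hd i k]
    have hdet := isUnit_det_of_dominant (by norm_num) hdiag hoffd
    refine ⟨hdet, fun i k => ?_, fun r k => ?_⟩
    · have h2 : ‖channel (m n) G' i k‖ ≤ M := by
        rw [norm_channel h0.le]
        exact (mul_le_of_le_one_left (norm_nonneg _) (pow_le_one₀ h0.le h1)).trans (hGM i k)
      have h3 := norm_le_norm_sub_add (A n j i k) (channel (m n) G' i k)
      linarith [hd i k]
    · have := norm_inv_le_of_weight hdet (c := 1 / 2) (by norm_num) k (w := fun _ => 1)
        (fun _ => one_pos) le_rfl hdiag (fun i k hk => by simpa using hoffd i k hk) r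
      norm_num at this
      exact this
  have hlow := eventually_le_instRate_effectivePrecoder hpt hm0 hm hG
    (D := fun i => (G i i)⁻¹) (fun i => inv_ne_zero (hG i)) (A := A) (M := M + 1)
    (hgood.mono fun n hn j => ⟨(hn j).1, (hn j).2.1⟩) (fun ε hε => ⟨K * (4 * |C|), ?_⟩) i hε
  · filter_upwards [hlow, hρ] with n h1 h2
    have : effectivePrecoder (p n) (A n) = effectivePrecoder (p n) (R n) := by
      ext j k
      simp only [effectivePrecoder, Matrix.of_apply, hA]
      rw [zfBeam_diagonal_mul _ _ (h2 j)]
    rwa [this] at h1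
  -- The factor `n + 1` from Borel–Cantelli is harmless because `p n` grows exponentially.
  · have hgrow : ∀ᶠ n : ℕ in atTop, (n : ℝ) + 1 ≤ p n ^ ε := by
      have h2 : (1 : ℝ) < 2 ^ ε := Real.one_lt_rpow one_lt_two hε
      filter_upwards [(tendsto_succ_div_pow h2).eventually (ge_mem_nhds one_pos)] with n hn
      rw [div_le_one (by positivity)] at hn
      refine hn.trans ?_
      rw [← Real.rpow_natCast, ← Real.rpow_mul zero_le_two, mul_comm, Real.rpow_mul zero_le_two,
        Real.rpow_natCast]
      exact Real.rpow_le_rpow (by positivity) (hp n) hε.le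
    filter_upwards [hgood, hR, hgrow, hm0, hm.eventually (ge_mem_nhds one_pos)] with
      n hgn hRn hgr h0 h1 j
    have hsq := Real.sqrt_pos.2 (hp0 n)
    have hmain : ∀ r k, √(p n) * ‖((A n j)⁻¹ * (A n j - channel (m n) G')) r k‖ ≤
        K * (4 * |C|) * p n ^ ε := by
      intro r k
      calc _ ≤ √(p n) * ∑ s, ‖(A n j)⁻¹ r s‖ * ‖(A n j - channel (m n) G') s k‖ := by
            gcongr
            rw [Matrix.mul_apply]
            exact (norm_sum_le _ _).trans (Finset.sum_le_sum fun s _ => (norm_mul _ _).le)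
        _ ≤ √(p n) * ∑ _s : Fin K, 4 * (|C| * ((n + 1) / √(p n))) := by
            gcongr with s _
            · exact (hgn j).2.2 r s
            · rw [Matrix.sub_apply, hAR]
              refine (hRn j s k).trans ?_
              gcongr
              exact le_abs_self C
        _ = K * (4 * |C|) * (n + 1) := by
            simp only [Finset.sum_const, Finset.card_univ, Fintype.card_fin, nsmul_eq_mul]
            field_simp
        _ ≤ _ := by gcongr
    exact ⟨hmain j, fun r k => (mul_le_of_le_one_right (by positivity)
      (pow_le_one₀ h0.le h1)).trans (hmain r k)⟩

theorem measurable_rvqPrecoder {Ω : Type*} [MeasurableSpace Ω] {K : ℕ}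
    {G : Ω → Matrix (Fin K) (Fin K) ℂ} (hG : ∀ i k, Measurable fun ω => G ω i k)
    {W : Fin K → Fin K → ℕ → Ω → Fin K → ℂ} (hW : ∀ i j n, Measurable (W i j n)) (μ μ' : ℝ → ℝ)
    (P : ℝ) (k l : Fin K) : Measurable fun ω => rvqPrecoder G W μ μ' P ω k l := by
  refine measurable_effectivePrecoder P (fun j i k => ?_) k l
  simp only [rvqEstimate, Matrix.of_apply, fixPhase]
  have hb := measurable_bestCodeword (hW i j)
    (h := fun ω => channel (μ P) (G ω) i) (measurable_pi_lambda _ fun k =>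
      measurable_channel _ hG i k) (2 ^ ⌈rvqBits K P (μ P) (μ' P) i j⌉₊ - 1)
  have hbk : ∀ k, Measurable fun ω => bestCodeword (fun n => W i j n ω) (channel (μ P) (G ω) i)
      (2 ^ ⌈rvqBits K P (μ P) (μ' P) i j⌉₊ - 1) k := fun k => (measurable_pi_apply k).comp hb
  exact ((continuous_star.measurable.comp (hbk i)).div
    (Complex.measurable_ofReal.comp (hbk i).norm)).mul (hbk k)

/-- Random vector quantization achieves the maximal multiplexing gain. -/
theorem achievesMaximalMG_rvqPrecoder {Ω : Type*} [MeasurableSpace Ω] {ν : Measure Ω}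
    [IsProbabilityMeasure ν] {K : ℕ} {G : Ω → Matrix (Fin K) (Fin K) ℂ} (hG : IsRayleigh ν G)
    {μ μ' : ℝ → ℝ} (hμ : ∀ᶠ P in atTop, 0 < μ P) (hμ0 : Tendsto μ atTop (𝓝 0))
    (hμ' : ∀ P, 0 < μ' P) {Cy : ℝ}
    (hCy : ∀ᶠ P in atTop, ∀ d < K, μ' P * (μ P / μ' P) ^ d ≤ Cy)
    {W : Fin K → Fin K → ℕ → Ω → Fin K → ℂ} (hW : ∀ i j, IsRandomCodebook ν G (W i j)) :
    AchievesMaximalMG ν (fun P ω => channel (μ P) (G ω)) (rvqPrecoder G W μ μ') := by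
  refine achievesMaximalMG_of_lower hG hμ hμ0
    (measurable_rvqPrecoder hG.1 (fun i j => (hW i j).1) μ μ')
    (fun P ω k l => norm_zfBeam_le P _ l k) fun p hp => ?_
  obtain ⟨φ, hφ, hφp⟩ := extraction_forall_of_eventually
    (P := fun n k => (2 : ℝ) ^ n ≤ p k) fun n => hp.eventually_ge_atTop _
  refine ⟨φ, hφ.tendsto_atTop, ?_⟩
  set q : ℕ → ℝ := fun n => p (φ n) with hq
  have hqt : Tendsto q atTop atTop := hp.comp hφ.tendsto_atTop
  have hq0 : ∀ n, 0 < q n := fun n => lt_of_lt_of_le (by positivity) (hφp n)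
  have hm0 : ∀ᶠ n in atTop, 0 < μ (q n) := hqt.eventually hμ
  have hm : Tendsto (fun n => μ (q n)) atTop (𝓝 0) := hμ0.comp hqt
  have hy : ∀ᶠ n in atTop, ∀ d < K, μ' (q n) * (μ (q n) / μ' (q n)) ^ d ≤ Cy := hqt.eventually hCy
  -- If `B` is the prescribed number of bits, `2 ^ B ≥ x ^ (K - 1)` for the argument `x` of the
  -- logarithm, and `r = (n + 1) / √x`. The factor `n + 1` makes the failure probabilities summable.
  set r : Fin K → Fin K → ℕ → ℝ := fun i j n =>
    ((n : ℝ) + 1) * (μ' (q n) * (μ (q n) / μ' (q n)) ^ gap i j) / √(q n) with hr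
  have hr0 : ∀ i j, ∀ᶠ n in atTop, 0 < r i j n := fun i j => by
    filter_upwards [hm0] with n h0
    have := hμ' (q n)
    have := Real.sqrt_pos.2 (hq0 n)
    simp only [hr]
    positivity
  have hrle : ∀ i j, ∀ᶠ n : ℕ in atTop, r i j n ≤ Cy * (((n : ℝ) + 1) / √(q n)) := fun i j => by
    filter_upwards [hy] with n hn
    calc r i j n ≤ ((n : ℝ) + 1) * Cy / √(q n) := by
          simp only [hr]
          gcongr
          exact hn _ (gap_lt i j)
      _ = _ := by ring
  have hrlim : ∀ i j, Tendsto (r i j) atTop (𝓝 0) := fun i j =>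
    squeeze_zero' ((hr0 i j).mono fun n h => h.le) (hrle i j) (tendsto_succ_div_sqrt hφp Cy)
  set N : Fin K → Fin K → ℕ → ℕ := fun i j n =>
    2 ^ ⌈rvqBits K (q n) (μ (q n)) (μ' (q n)) i j⌉₊ with hN
  have hunit : ∀ᵐ ω ∂ν, ∀ i j n, l2norm (W i j n ω) = 1 := by
    rw [ae_all_iff]; intro i
    rw [ae_all_iff]; intro j
    rw [ae_all_iff]; intro n
    have h := ae_isotropicLaw_l2norm_eq_one i
    rw [← (hW i j).2.2.1 n] at h
    exact ae_of_ae_map ((hW i j).1 n).aemeasurable h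
  have hcap : ∀ᵐ ω ∂ν, ∀ i j, ∀ᶠ n in atTop,
      (1 - (K * r i j n) ^ 2) * l2norm (channel (μ (q n)) (G ω) i) ^ 2 ≤
        ‖star (bestCodeword (fun k => W i j k ω) (channel (μ (q n)) (G ω) i) (N i j n - 1)) ⬝ᵥ
          channel (μ (q n)) (G ω) i‖ ^ 2 := by
    rw [ae_all_iff]; intro i
    rw [ae_all_iff]; intro j
    rcases Nat.lt_or_ge K 2 with hK | hK
    -- For `K = 1` no bits are spent and the exponent `2 * (K - 1)` vanishes, but every unit vector
    -- spans the whole line.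
    · filter_upwards [hunit] with ω hω
      refine Eventually.of_forall fun n => ?_
      rw [norm_star_dotProduct_of_card_one (by have := i.pos; omega)]
      obtain ⟨k, hk⟩ := exists_bestCodeword_eq (fun k => W i j k ω) (channel (μ (q n)) (G ω) i)
        (N i j n - 1)
      rw [hk, hω i j k]
      gcongr
      linarith [sq_nonneg (K * r i j n)]
    · refine ae_eventually_cap hG (hW i j) i hm0 hm ?_ ?_
      · filter_upwards [hr0 i j, (hrlim i j).eventually (ge_mem_nhds one_pos)] with n h1 h2
        exact ⟨h1.le, h2⟩
      · filter_upwards [hm0] with n h0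
        have hμ'n := hμ' (q n)
        have hqn := hq0 n
        set x := q n / μ' (q n) ^ 2 * (μ' (q n) ^ (2 * gap i j) / μ (q n) ^ (2 * gap i j)) with hx
        have hx0 : 0 < x := by positivity
        have hrx : r i j n ^ 2 = ((n : ℝ) + 1) ^ 2 / x := by
          simp only [hr, hx]
          rw [div_pow, Real.sq_sqrt hqn.le, mul_pow, mul_pow, div_pow, div_pow, ← pow_mul,
            ← pow_mul, mul_comm (gap i j) 2]
          field_simp
        have h1 : x ^ (K - 1) ≤ (N i j n : ℝ) := by
          have := pow_le_two_pow_ceil hx0 (K := K) (by omega)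
          simpa [hN, rvqBits] using this
        calc (n : ℝ) + 1 = ((n : ℝ) + 1) ^ 1 := (pow_one _).symm
          _ ≤ ((n : ℝ) + 1) ^ (2 * (K - 1)) :=
              pow_le_pow_right₀ (by linarith [(n.cast_nonneg : (0 : ℝ) ≤ n)]) (by omega)
          _ = x ^ (K - 1) * r i j n ^ (2 * (K - 1)) := by
              rw [pow_mul (r i j n), hrx, div_pow, ← pow_mul]
              field_simp
          _ ≤ _ := by gcongr
  filter_upwards [hG.ae_ne_zero, hunit, hcap] with ω hne hun hca i ε hε
  have hK : (0 : ℝ) < K := by exact_mod_cast i.pos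
  set b : ℕ → Fin K → Fin K → Fin K → ℂ := fun n j i =>
    bestCodeword (fun k => W i j k ω) (channel (μ (q n)) (G ω) i) (N i j n - 1) with hb
  have hbu : ∀ n j i, l2norm (b n j i) = 1 := fun n j i => by
    obtain ⟨k, hk⟩ := exists_bestCodeword_eq (fun k => W i j k ω) (channel (μ (q n)) (G ω) i)
      (N i j n - 1)
    rw [hb]
    simp only
    rw [hk, hun]
  have hkey : ∀ᶠ n : ℕ in atTop, ∀ j i, 0 < ‖b n j i i‖⁻¹ ∧ ∀ k,
      ‖((‖b n j i i‖⁻¹ : ℝ) : ℂ) * fixPhase i (b n j i) k -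
        channel (μ (q n)) (Matrix.of fun i k => (G ω i i)⁻¹ * G ω i k) i k‖ ≤
        8 * K * (K * Cy) * ((n + 1) / √(q n)) := by
    rw [eventually_all]; intro j
    rw [eventually_all]; intro i
    have hlim : Tendsto (fun n => K * r i j n) atTop (𝓝 (K * 0)) := (hrlim i j).const_mul _
    rw [mul_zero] at hlim
    filter_upwards [hca i j, hr0 i j, hrle i j,
      hlim.eventually (ge_mem_nhds (show (0 : ℝ) < 1 / (4 * K) by positivity)),
      hlim.eventually (ge_mem_nhds (show (0 : ℝ) < 1 / 2 by positivity)),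
      eventually_norm_channel_le_diag hm0 hm i (hne i i)] with n h1 h2 h3 h4 h5 h6
    have hcii : channel (μ (q n)) (G ω) i i = G ω i i := by simp [channel, gap_self]
    obtain ⟨h7, h8⟩ := norm_fixPhase_sub_le (hbu n j i) (hcii ▸ hne i i) h6 (by positivity) h4 h5 h1
    refine ⟨inv_pos.2 h7, fun k => ?_⟩
    have h9 : channel (μ (q n)) (Matrix.of fun i k => (G ω i i)⁻¹ * G ω i k) i k =
        (channel (μ (q n)) (G ω) i i)⁻¹ * channel (μ (q n)) (G ω) i k := by
      rw [hcii]
      simp only [channel, Matrix.of_apply]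
      ring
    rw [h9]
    refine (h8 k).trans ?_
    calc 8 * K * (K * r i j n) ≤ 8 * K * (K * (Cy * ((n + 1) / √(q n)))) := by gcongr
      _ = _ := by ring
  exact eventually_le_instRate_of_directions (fun i => hne i i) hφp hm0 hm
    (ρ := fun n j i => ‖b n j i i‖⁻¹) (hkey.mono fun n hn j i => (hn j i).1)
    (hkey.mono fun n hn j i => (hn j i).2) i hε

theorem mainTheorem4 {Ω : Type*} [MeasurableSpace Ω] (ν : Measure Ω) [IsProbabilityMeasure ν]
    (K : ℕ) (G : Ω → Matrix (Fin K) (Fin K) ℂ) (hG : IsRayleigh ν G)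
    (μ : ℝ → ℝ) (hμ : ∀ᶠ P in atTop, 0 < μ P) (hμ0 : Tendsto μ atTop (𝓝 0)) :
    (∃ γ' : ℝ → ℝ, IsInverseDecayRate ν (fun P ω => channel (μ P) (G ω)) γ' ∧
      ∀ᶠ P in atTop, Real.exp (-γ' P) ≤ μ P) ∧
    ∀ γ' : ℝ → ℝ, IsInverseDecayRate ν (fun P ω => channel (μ P) (G ω)) γ' →
      (∀ W : Fin K → Fin K → ℕ → Ω → Fin K → ℂ, (∀ i j, IsRandomCodebook ν G (W i j)) →
        AchievesMaximalMG ν (fun P ω => channel (μ P) (G ω))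
          (rvqPrecoder G W μ fun P => Real.exp (-γ' P))) ∧
      (∀ L : ℕ → ℝ, IsAdmissibleRange L →
        ∀ a : Fin K → Matrix (Fin K) (Fin K) ℂ, (∀ j i, a j i i ≠ 0) →
        AchievesMaximalMG ν (fun P ω => channel (μ P) (G ω))
          (scalarPrecoder G L a μ fun P => Real.exp (-γ' P))) := by
  refine ⟨⟨fun P => -Real.log (μ P), isInverseDecayRate_neg_log hG hμ hμ0, ?_⟩, fun γ' hγ' => ?_⟩
  · filter_upwards [hμ] with P hP
    rw [neg_neg, Real.exp_log hP]
  · obtain ⟨C, -, hC⟩ := hγ'.eventually_le hG hμ hμ0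
    exact ⟨fun W hW => achievesMaximalMG_rvqPrecoder hG hμ hμ0 (fun P => Real.exp_pos _) hC hW,
      fun L hL a ha =>
        achievesMaximalMG_scalarPrecoder hG hμ hμ0 (fun P => Real.exp_pos _) hC hL ha⟩
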